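/- Let $K$ be a field. A cyclic Nakayama algebra of rank $n$ is a bound quiver algebra $\Lambda=KQ/I$, where $Q$ is the oriented cycle with vertices $1,\dots,n$ and arrows $i\to i+1$ (indices modulo $n$) and $I$ is an admissible ideal; it is a finite dimensional algebra with exactly $n$ simple modules up to isomorphism, and all its finitely generated indecomposable modules are uniserial. Its Kupisch series is $(c_1,\dots,c_n)$, where $c_i$ is the length of the indecomposable projective module $P_i$ at the vertex $i$; here the composition factors of $P_i$ are, from the top, $S_i,S_{i+1},\dots$. In a Kupisch series $a^b$ stands for $b$ consecutive entries equal to $a$. A finite dimensional algebra is a higher Auslander algebra if its dominant dimension equals its global dimension. **Proposition.** For every odd integer $k\ge 3$ the following hold. 1. There is a cyclic Nakayama algebra of rank $n=k+2$ over $K$ that is a higher Auslander algebra of global dimension $k$, namely one with Kupisch series $(n,\,n-1,\,(n-2)^{n-2})$. 2. There is a cyclic Nakayama algebra of rank $k+3$ over $K$ that is a higher Auslander algebra of global dimension $k$, namely one with Kupisch series $(m,\,(m-1)^{m-1},\,m,\,(m-1)^{m-1})$, where $m=(k+3)/2$. (It is the double cover of the cyclic Nakayama algebra of rank $m$ with Kupisch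 series $(m,(m-1)^{m-1})$, that is, its Kupisch series is that series repeated twice.) -/

import Mathlib

open CategoryTheory

universe u v w

noncomputable section

/-! ### Path algebras and bound quiver algebras -/

/-- The path algebra `K Q` of a quiver `Q` on the vertex set `V`: the `K`-vector space whose basis
is the set of all paths of `Q`, trivial paths included. -/
def PathAlgebra (K : Type u) [Field K] (V : Type v) [Quiver.{w} V] :=
  (Σ a b : V, Quiver.Path a b) →₀ K

namespace PathAlgebra

variable (K : Type u) [Field K] {V : Type v} [Quiver.{w} V]

instance : AddCommGroup (PathAlgebra K V) :=
  inferInstanceAs (AddCommGroup ((Σ a b : V, Quiver.Path a b) →₀ K))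

instance : Module K (PathAlgebra K V) :=
  inferInstanceAs (Module K ((Σ a b : V, Quiver.Path a b) →₀ K))

variable (V) in
/-- The basis of the path algebra that consists of all paths. -/
def pathBasis : Module.Basis (Σ a b : V, Quiver.Path a b) K (PathAlgebra K V) :=
  Module.Basis.ofRepr (LinearEquiv.refl K ((Σ a b : V, Quiver.Path a b) →₀ K))

/-- The basis element given by a path. -/
def ofPath {a b : V} (p : Quiver.Path a b) : PathAlgebra K V := pathBasis K V ⟨a, b, p⟩

open Classical in
/-- The product of two paths. Paths are composed like functions: `q * p` is the path `p` followed
by the path `q` if `p` ends where `q` starts, and `q * p = 0` otherwise. -/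
def pathMul (q p : Σ a b : V, Quiver.Path a b) : PathAlgebra K V :=
  if h : p.2.1 = q.1 then ofPath K ((p.2.2.cast rfl h).comp q.2.2) else 0

/-- The `K`-bilinear extension of the product of paths. -/
def mulHom : PathAlgebra K V →ₗ[K] PathAlgebra K V →ₗ[K] PathAlgebra K V :=
  (pathBasis K V).constr K fun q => (pathBasis K V).constr K fun p => pathMul K q p

instance : Mul (PathAlgebra K V) := ⟨fun x y => mulHom K x y⟩

/-- The unit element is the sum of the trivial paths. -/
instance [Fintype V] : One (PathAlgebra K V) :=
  ⟨∑ a : V, ofPath K (Quiver.Path.nil : Quiver.Path a a)⟩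

theorem mul_def (x y : PathAlgebra K V) : x * y = mulHom K x y := rfl

theorem one_def [Fintype V] :
    (1 : PathAlgebra K V) = ∑ a : V, ofPath K (Quiver.Path.nil : Quiver.Path a a) := rfl

theorem ofPath_mul_ofPath {a b c : V} (q : Quiver.Path b c) (p : Quiver.Path a b) :
    ofPath K q * ofPath K p = ofPath K (p.comp q) := by
  simp [mul_def, mulHom, ofPath, pathMul]

theorem ofPath_mul_ofPath_of_ne {a b c d : V} (q : Quiver.Path c d) (p : Quiver.Path a b)
    (h : b ≠ c) : ofPath K q * ofPath K p = 0 := by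
  simp [mul_def, mulHom, ofPath, pathMul, h]

variable {K} in
theorem induction_on {P : PathAlgebra K V → Prop} (x : PathAlgebra K V) (h0 : P 0)
    (hadd : ∀ x y, P x → P y → P (x + y))
    (hsmul : ∀ (r : K) (a b : V) (p : Quiver.Path a b), P (r • ofPath K p)) : P x := by
  rw [← (pathBasis K V).linearCombination_repr x, Finsupp.linearCombination_apply]
  exact Finset.sum_induction _ P hadd h0 fun i _ => hsmul _ _ _ i.2.2

theorem pa_add_mul (x y z : PathAlgebra K V) : (x + y) * z = x * z + y * z := by
  simp only [mul_def, map_add, LinearMap.add_apply]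

theorem pa_mul_add (x y z : PathAlgebra K V) : x * (y + z) = x * y + x * z := by
  simp only [mul_def, map_add]

theorem pa_smul_mul (r : K) (x y : PathAlgebra K V) : (r • x) * y = r • (x * y) := by
  simp only [mul_def, map_smul, LinearMap.smul_apply]

theorem pa_mul_smul (r : K) (x y : PathAlgebra K V) : x * (r • y) = r • (x * y) := by
  simp only [mul_def, map_smul]

theorem pa_zero_mul (x : PathAlgebra K V) : 0 * x = 0 := by
  simp only [mul_def, map_zero, LinearMap.zero_apply]

theorem pa_mul_zero (x : PathAlgebra K V) : x * 0 = 0 := by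
  simp only [mul_def, map_zero]

theorem pa_mul_assoc (x y z : PathAlgebra K V) : x * y * z = x * (y * z) := by
  induction x using induction_on with
  | h0 => simp only [pa_zero_mul]
  | hadd x x' hx hx' => simp only [pa_add_mul, hx, hx']
  | hsmul r a b p =>
    simp only [pa_smul_mul]
    congr 1
    induction y using induction_on with
    | h0 => simp only [pa_zero_mul, pa_mul_zero]
    | hadd y y' hy hy' => simp only [pa_add_mul, pa_mul_add, hy, hy']
    | hsmul s c d q =>
      simp only [pa_smul_mul, pa_mul_smul]
      congr 1
      induction z using induction_on with
      | h0 => simp only [pa_mul_zero]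
      | hadd z z' hz hz' => simp only [pa_mul_add, hz, hz']
      | hsmul t e f s =>
        simp only [pa_mul_smul]
        congr 1
        by_cases h1 : d = a
        · subst h1
          rw [ofPath_mul_ofPath]
          by_cases h2 : f = c
          · subst h2
            rw [ofPath_mul_ofPath, ofPath_mul_ofPath, ofPath_mul_ofPath, Quiver.Path.comp_assoc]
          · rw [ofPath_mul_ofPath_of_ne K _ _ h2, ofPath_mul_ofPath_of_ne K _ _ h2, pa_mul_zero]
        · rw [ofPath_mul_ofPath_of_ne K _ _ h1, pa_zero_mul]
          by_cases h2 : f = c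
          · subst h2
            rw [ofPath_mul_ofPath, ofPath_mul_ofPath_of_ne K _ _ h1]
          · rw [ofPath_mul_ofPath_of_ne K _ _ h2, pa_mul_zero]

theorem pa_one_mul [Fintype V] (x : PathAlgebra K V) : 1 * x = x := by
  induction x using induction_on with
  | h0 => rw [pa_mul_zero]
  | hadd x y hx hy => rw [pa_mul_add, hx, hy]
  | hsmul r a b p =>
    rw [pa_mul_smul]
    congr 1
    rw [one_def, mul_def, map_sum, LinearMap.sum_apply, Finset.sum_eq_single b]
    · rw [← mul_def, ofPath_mul_ofPath, Quiver.Path.comp_nil]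
    · intro c _ hc
      rw [← mul_def, ofPath_mul_ofPath_of_ne K _ _ hc.symm]
    · intro h
      exact absurd (Finset.mem_univ b) h

theorem pa_mul_one [Fintype V] (x : PathAlgebra K V) : x * 1 = x := by
  induction x using induction_on with
  | h0 => rw [pa_zero_mul]
  | hadd x y hx hy => rw [pa_add_mul, hx, hy]
  | hsmul r a b p =>
    rw [pa_smul_mul]
    congr 1
    rw [one_def, mul_def, map_sum, Finset.sum_eq_single a]
    · rw [← mul_def, ofPath_mul_ofPath, Quiver.Path.nil_comp]
    · intro c _ hc
      rw [← mul_def, ofPath_mul_ofPath_of_ne K _ _ hc]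
    · intro h
      exact absurd (Finset.mem_univ a) h

instance [Fintype V] : Ring (PathAlgebra K V) where
  left_distrib := pa_mul_add K
  right_distrib := pa_add_mul K
  zero_mul := pa_zero_mul K
  mul_zero := pa_mul_zero K
  mul_assoc := pa_mul_assoc K
  one_mul := pa_one_mul K
  mul_one := pa_mul_one K
  neg_add_cancel := neg_add_cancel
  sub_eq_add_neg := sub_eq_add_neg
  nsmul := fun n x => n • x
  nsmul_zero := zero_nsmul
  nsmul_succ := fun n x => succ_nsmul x n
  zsmul := fun n x => n • x
  zsmul_zero' := zero_zsmul
  zsmul_succ' := SubNegMonoid.zsmul_succ'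
  zsmul_neg' := SubNegMonoid.zsmul_neg'

instance [Fintype V] : Algebra K (PathAlgebra K V) :=
  Algebra.ofModule (pa_smul_mul K) (pa_mul_smul K)

variable (V) in
/-- The `j`-th power of the arrow ideal of the path algebra, as a subspace: the span of all paths
of length at least `j`. -/
def arrowIdealPow (j : ℕ) : Submodule K (PathAlgebra K V) :=
  Submodule.span K {x | ∃ (a b : V) (p : Quiver.Path a b), j ≤ p.length ∧ x = ofPath K p}

variable {K} in
/-- An ideal `I` of the path algebra is admissible if `R ^ m ⊆ I ⊆ R ^ 2` for some `m ≥ 2`, where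
`R` is the arrow ideal. -/
def IsAdmissible [Fintype V] (I : TwoSidedIdeal (PathAlgebra K V)) : Prop :=
  (∀ x ∈ I, x ∈ arrowIdealPow K V 2) ∧ ∃ m : ℕ, 2 ≤ m ∧ ∀ x ∈ arrowIdealPow K V m, x ∈ I

end PathAlgebra

/-- The bound quiver algebra `K Q / I`. -/
abbrev BoundQuiverAlgebra {K : Type u} [Field K] {V : Type v} [Quiver.{w} V] [Fintype V]
    (I : TwoSidedIdeal (PathAlgebra K V)) := I.ringCon.Quotient

/-- The primitive idempotent `e_a` of `K Q / I` at the vertex `a`. -/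
def vertexIdempotent {K : Type u} [Field K] {V : Type v} [Quiver.{w} V] [Fintype V]
    (I : TwoSidedIdeal (PathAlgebra K V)) (a : V) : BoundQuiverAlgebra I :=
  I.ringCon.mk' (PathAlgebra.ofPath K (Quiver.Path.nil : Quiver.Path a a))

/-- The indecomposable projective module `P_a = (K Q / I) e_a` at the vertex `a`; it is spanned by
the classes of the paths that start at `a`, and its top is the simple module at `a`. -/
def projectiveAt {K : Type u} [Field K] {V : Type v} [Quiver.{w} V] [Fintype V]
    (I : TwoSidedIdeal (PathAlgebra K V)) (a : V) :
    Submodule (BoundQuiverAlgebra I) (BoundQuiverAlgebra I) :=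
  Submodule.span (BoundQuiverAlgebra I) {vertexIdempotent I a}

/-! ### The cyclic quiver and Nakayama algebras -/

/-- The vertex set of the oriented cycle with `n` vertices. The vertices `1, …, n` of the usual
numbering are the residue classes of `0, …, n - 1`. -/
def CyclicQuiver (n : ℕ) := ZMod n

instance (n : ℕ) [NeZero n] : Fintype (CyclicQuiver n) := inferInstanceAs (Fintype (ZMod n))

instance (n : ℕ) : CommRing (CyclicQuiver n) := inferInstanceAs (CommRing (ZMod n))

/-- The oriented cycle: exactly one arrow `i ⟶ i + 1` for every vertex `i`, and no other arrow. -/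
instance (n : ℕ) : Quiver (CyclicQuiver n) where
  Hom i j := PLift (j = i + 1)

/-- A module is uniserial if its submodules form a chain. -/
def IsUniserial (A : Type u) [Ring A] (M : Type v) [AddCommGroup M] [Module A M] : Prop :=
  ∀ N N' : Submodule A M, N ≤ N' ∨ N' ≤ N

/-- A module is indecomposable if it is nonzero and not the direct sum of two nonzero
submodules. -/
def IsIndecomposableModule (A : Type u) [Ring A] (M : Type v) [AddCommGroup M] [Module A M] :
    Prop :=
  Nontrivial M ∧ ∀ N N' : Submodule A M, IsCompl N N' → N = ⊥ ∨ N' = ⊥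

/-- A Nakayama algebra: a finite dimensional algebra all of whose finitely generated
indecomposable modules are uniserial. -/
def IsNakayama (K : Type u) [Field K] (A : Type u) [Ring A] [Algebra K A] : Prop :=
  Module.Finite K A ∧ ∀ (M : Type u) [AddCommGroup M] [Module A M], Module.Finite A M →
    IsIndecomposableModule A M → IsUniserial A M

/-- `K Q / I`, with `Q` the oriented cycle with `n` vertices, is a cyclic Nakayama algebra: `I` is
admissible and `K Q / I` is a Nakayama algebra. -/
def IsCyclicNakayama {K : Type u} [Field K] {n : ℕ} [NeZero n]
    (I : TwoSidedIdeal (PathAlgebra K (CyclicQuiver n))) : Prop :=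
  PathAlgebra.IsAdmissible I ∧ IsNakayama K (BoundQuiverAlgebra I)

/-- The list `l = [c_1, …, c_n]` is the Kupisch series of `K Q / I`, with `Q` the oriented cycle
with `n` vertices: `c_i` is the length of the indecomposable projective module `P_i` at the `i`-th
vertex. -/
def HasKupischSeries {K : Type u} [Field K] {n : ℕ} [NeZero n]
    (I : TwoSidedIdeal (PathAlgebra K (CyclicQuiver n))) (l : List ℕ) : Prop :=
  l.length = n ∧ ∀ (i : ℕ) (hi : i < l.length),
    Module.length (BoundQuiverAlgebra I) (projectiveAt I (i : CyclicQuiver n)) = (l[i] : ℕ)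

/-! ### Rank, global dimension, dominant dimension -/

/-- Two maximal left ideals are related if the simple modules that they define are isomorphic. -/
def simpleQuotientSetoid (A : Type u) [Ring A] : Setoid {m : Ideal A // m.IsMaximal} where
  r m m' := Nonempty ((A ⧸ m.1) ≃ₗ[A] (A ⧸ m'.1))
  iseqv := ⟨fun _ => ⟨LinearEquiv.refl A _⟩, fun ⟨e⟩ => ⟨e.symm⟩, fun ⟨e⟩ ⟨f⟩ => ⟨e.trans f⟩⟩

/-- The rank of an algebra: the number of isomorphism classes of simple modules. (Every simple
module is a quotient of `A` by a maximal left ideal.) -/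
def algebraRank (A : Type u) [Ring A] : ℕ := Nat.card (Quotient (simpleQuotientSetoid A))

/-- The global dimension: the supremum of the projective dimensions of all finitely generated
modules. -/
def globalDimension (A : Type u) [Ring A] : WithBot ℕ∞ :=
  ⨆ (M : ModuleCat.{u} A) (_ : Module.Finite A M), projectiveDimension M

/-- A submodule is essential if it meets every nonzero submodule in a nonzero submodule. -/
def IsEssentialSubmodule {A : Type u} [Ring A] {M : Type v} [AddCommGroup M] [Module A M]
    (N : Submodule A M) : Prop :=
  ∀ L : Submodule A M, N ⊓ L = ⊥ → L = ⊥

/-- `0 → M → I_0 → I_1 → ⋯` is a minimal injective resolution of `M`: it is exact, all `I_i` are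
injective, `I_0` is an injective envelope of `M`, and `I_{i+1}` is an injective envelope of the
image of `I_i`. -/
structure IsMinimalInjectiveResolution {A : Type u} [Ring A] (M : ModuleCat.{u} A)
    (I : ℕ → ModuleCat.{u} A) (ε : M →ₗ[A] I 0) (d : ∀ i, I i →ₗ[A] I (i + 1)) : Prop where
  injective : ∀ i, Module.Injective A (I i)
  ker_eq_bot : LinearMap.ker ε = ⊥
  exact_zero : LinearMap.range ε = LinearMap.ker (d 0)
  exact_succ : ∀ i, LinearMap.range (d i) = LinearMap.ker (d (i + 1))
  essential_zero : IsEssentialSubmodule (LinearMap.range ε)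
  essential_succ : ∀ i, IsEssentialSubmodule (LinearMap.range (d i))

/-- The dominant dimension: the supremum of all `m` such that the terms `I_0, …, I_{m-1}` of the
minimal injective resolution of the regular module are projective. -/
def dominantDimension (A : Type u) [Ring A] : ℕ∞ :=
  sSup {m : ℕ∞ | ∃ (I : ℕ → ModuleCat.{u} A) (ε : ModuleCat.of A A →ₗ[A] I 0)
    (d : ∀ i, I i →ₗ[A] I (i + 1)), IsMinimalInjectiveResolution (ModuleCat.of A A) I ε d ∧
      ∀ i : ℕ, (i : ℕ∞) < m → Module.Projective A (I i)}

/-- A finite dimensional algebra is a higher Auslander algebra if its dominant dimension equals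
its global dimension. -/
def IsHigherAuslander (K : Type u) [Field K] (A : Type u) [Ring A] [Algebra K A] : Prop :=
  Module.Finite K A ∧ (dominantDimension A : WithBot ℕ∞) = globalDimension A

end

/-!
For a Kupisch series `c` with `c a ≤ c (a + 1) + 1`, the paths that start at a vertex `a` and have
length at least `c a` span an ideal of the path algebra of the oriented cycle. In the quotient `A`,
let `e a` be the idempotents of the vertices and `t` the sum of all arrows. Then `A` is spanned by
the elements `t ^ i * e a`, which vanish exactly for `c a ≤ i`; this is a `CyclicPresentation`, and
everything else follows from it.

If `e a • x = x`, then every element of `A` acts on `x` like a polynomial in `t`. As the submodules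
of `K[t] / t ^ l` are generated by powers of `t`, a module generated by such an `x` is uniserial,
and it is determined by the vertex `a` and the least `l` with `t ^ l • x = 0`
(`CyclicPresentation.IsInterval`). Write `M(a, l)` for it, so that `P_a = M(a, c a)`. The submodules
of `M(a, l)` are the modules `M(a + i, l - i)`, and the quotients are the modules `M(a, i)`.
The key lemma `exists_isCompl_span` splits off a uniserial submodule of a module with the help of a
linear functional that does not vanish on its socle. Applied to a uniserial submodule of maximal
length, it shows that indecomposable modules are uniserial; applied to arbitrary extensions of
`M(a, l)`, it shows that `M(a, l)` is injective if `c (a - 1) ≤ l`.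

The syzygy of `M(a, l)` is `M(a + l, c a - l)`, and if `P_b` is injective, then the cosyzygy of its
submodule `M(b + j, c b - j)` is `M(b, j)`. For both Kupisch series these two rules give that all
simple modules have projective dimension at most `k`, hence so have all finitely generated modules,
and that the first `k` terms of the minimal injective resolution of `A` are projective. Dimension
shifting (`IsMinimalInjectiveResolution.injective_of_hasProjectiveDimensionLE`) shows that if the
terms `I 0, …, I d` are projective and the global dimension is at most `d`, then `A` is
self-injective. Since `A` is not self-injective, `k ≤ domdim A ≤ gldim A ≤ k`.
-/

/-! ### Cyclic presentations and uniserial modules -/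

/-- A presentation of the `K`-algebra `A` as the Nakayama algebra on the oriented cycle with `n`
vertices and with Kupisch series `c`: orthogonal idempotents `e a` for the vertices, and the sum
`t` of all arrows. The path of length `i` that starts at `a` is `t ^ i * e a`. -/
structure CyclicPresentation (K : Type u) (A : Type v) [Field K] [Ring A] [Algebra K A]
    (n : ℕ) [NeZero n] (c : ZMod n → ℕ) where
  /-- the idempotent of a vertex -/
  e : ZMod n → A
  /-- the sum of all arrows -/
  t : A
  e_mul_self : ∀ a, e a * e a = e a
  e_mul_of_ne : ∀ a b, a ≠ b → e a * e b = 0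
  sum_e : ∑ a, e a = 1
  t_mul_e : ∀ a, t * e a = e (a + 1) * t
  pow_mul_e_eq_zero : ∀ a, t ^ c a * e a = 0
  pow_mul_e_ne_zero : ∀ a i, i < c a → t ^ i * e a ≠ 0
  mem_span : ∀ x, x ∈ Submodule.span K {y | ∃ (i : ℕ) (a : ZMod n), y = t ^ i * e a}

namespace CyclicPresentation

open Polynomial

variable {K : Type u} {A : Type v} [Field K] [Ring A] [Algebra K A] {n : ℕ} [NeZero n]
  {c : ZMod n → ℕ} (D : CyclicPresentation K A n c)
variable {M : Type w} [AddCommGroup M] [Module A M]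

theorem pow_mul_e (i : ℕ) (a : ZMod n) : D.t ^ i * D.e a = D.e (a + i) * D.t ^ i := by
  induction i with
  | zero => simp
  | succ i ih =>
    rw [pow_succ', mul_assoc, ih, ← mul_assoc, D.t_mul_e, mul_assoc, ← pow_succ']
    push_cast; ring_nf

theorem exists_mul_e_eq_aeval (r : A) (a : ZMod n) :
    ∃ p : K[X], r * D.e a = aeval D.t p * D.e a := by
  induction D.mem_span r using Submodule.span_induction with
  | mem x h =>
    obtain ⟨i, b, rfl⟩ := h
    by_cases hb : b = a
    · exact ⟨X ^ i, by simp [hb, mul_assoc, D.e_mul_self]⟩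
    · exact ⟨0, by simp [mul_assoc, D.e_mul_of_ne b a hb]⟩
  | zero => exact ⟨0, by simp⟩
  | add x y _ _ hx hy =>
    obtain ⟨p, hp⟩ := hx
    obtain ⟨q, hq⟩ := hy
    exact ⟨p + q, by simp [add_mul, hp, hq]⟩
  | smul k x _ hx =>
    obtain ⟨p, hp⟩ := hx
    exact ⟨k • p, by simp [hp]⟩

theorem exists_smul_eq_aeval {a : ZMod n} (r : A) :
    ∃ p : K[X], ∀ {M : Type w} [AddCommGroup M] [Module A M] (x : M), D.e a • x = x →
      r • x = aeval D.t p • x := by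
  obtain ⟨p, hp⟩ := D.exists_mul_e_eq_aeval r a
  refine ⟨p, fun x hx => ?_⟩
  rw [← hx, ← mul_smul, hp, mul_smul]

theorem e_smul_pow_smul {x : M} {a : ZMod n} (hx : D.e a • x = x) (i : ℕ) :
    D.e (a + i) • D.t ^ i • x = D.t ^ i • x := by
  rw [← mul_smul, ← D.pow_mul_e, mul_smul, hx]

theorem e_smul_e_smul (a : ZMod n) (x : M) : D.e a • D.e a • x = D.e a • x := by
  rw [← mul_smul, D.e_mul_self]

theorem eq_sum_e_smul (x : M) : x = ∑ a, D.e a • x := by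
  rw [← Finset.sum_smul, D.sum_e, one_smul]

theorem exists_e_smul_ne_zero {x : M} (hx : x ≠ 0) : ∃ a, D.e a • x ≠ 0 := by
  by_contra! h
  exact hx (by rw [D.eq_sum_e_smul x]; simp [h])

/-- The module `M` is uniserial with top the simple module at `a` and of length `l`, and `x`
is a generator of it that lies in `e a • M`. -/
structure IsInterval (x : M) (a : ZMod n) (l : ℕ) : Prop where
  e_smul : D.e a • x = x
  pow_smul : D.t ^ l • x = 0
  pow_smul_ne : ∀ i < l, D.t ^ i • x ≠ 0
  span_eq : Submodule.span A {x} = ⊤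

variable {D}

theorem pow_smul_eq_zero_of_le {x : M} {i l : ℕ} (h : i ≤ l) (hx : D.t ^ i • x = 0) :
    D.t ^ l • x = 0 := by
  rw [← Nat.sub_add_cancel h, pow_add, mul_smul, hx, smul_zero]

/-- Let `t ^ l` kill `x`. Then for every polynomial `p` there is a power of `t` such that `p(t) • x`
and `t ^ i • x` are multiples of each other. -/
theorem exists_aeval_smul {x : M} {l : ℕ} (hl : D.t ^ l • x = 0) (p : K[X]) :
    ∃ i ≤ l, ∃ q r : K[X], aeval D.t p • x = aeval D.t q • D.t ^ i • x ∧
      D.t ^ i • x = aeval D.t r • aeval D.t p • x := by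
  rcases eq_or_ne p 0 with rfl | hp
  · exact ⟨l, le_rfl, 0, 0, by simp, by simp [hl]⟩
  obtain ⟨q, hq, hq'⟩ := Polynomial.exists_eq_pow_rootMultiplicity_mul_and_not_dvd p hp 0
  rw [C_0, sub_zero] at hq hq'
  set i := p.rootMultiplicity 0
  have hpi : aeval D.t p • x = aeval D.t q • D.t ^ i • x := by
    rw [hq, mul_comm]; simp [mul_smul]
  rcases le_or_gt i l with hi | hi
  · obtain ⟨u, v, huv⟩ : IsCoprime q (X ^ l) :=
      (((Polynomial.irreducible_X).coprime_iff_not_dvd).2 hq').symm.pow_right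
    refine ⟨i, hi, q, u, hpi, ?_⟩
    have h0 : D.t ^ l • D.t ^ i • x = 0 := by
      rw [← mul_smul, ← pow_add]; exact pow_smul_eq_zero_of_le (by lia) hl
    rw [hpi, ← mul_smul, ← map_mul]
    conv_lhs => rw [← one_smul A (D.t ^ i • x), ← map_one (aeval (R := K) D.t), ← huv]
    rw [map_add, add_smul, map_mul (aeval D.t) v, mul_smul (aeval D.t v), aeval_X_pow, h0,
      smul_zero, add_zero]
  · exact ⟨l, le_rfl, 0, 0, by
      rw [hpi, pow_smul_eq_zero_of_le hi.le hl]; simp, by simp [hl]⟩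

namespace IsInterval

variable {x : M} {a : ZMod n} {l : ℕ}

theorem exists_smul_eq (h : D.IsInterval x a l) (m : M) : ∃ r : A, r • x = m :=
  Submodule.mem_span_singleton.1 (h.span_eq ▸ Submodule.mem_top)

theorem pow_smul_eq_zero_iff (h : D.IsInterval x a l) {i : ℕ} : D.t ^ i • x = 0 ↔ l ≤ i :=
  ⟨fun hi => by by_contra! hl; exact h.pow_smul_ne i hl hi,
    fun hi => pow_smul_eq_zero_of_le hi h.pow_smul⟩

theorem exists_span_singleton_eq (h : D.IsInterval x a l) (m : M) :
    ∃ i ≤ l, Submodule.span A {m} = Submodule.span A {D.t ^ i • x} := by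
  obtain ⟨r, rfl⟩ := h.exists_smul_eq m
  obtain ⟨p, hp⟩ := D.exists_smul_eq_aeval (a := a) r
  obtain ⟨i, hi, q, s, h1, h2⟩ := exists_aeval_smul h.pow_smul p
  refine ⟨i, hi, le_antisymm ?_ ?_⟩ <;> rw [Submodule.span_singleton_le_iff_mem,
    Submodule.mem_span_singleton]
  · exact ⟨_, by rw [hp x h.e_smul, h1]⟩
  · exact ⟨_, by rw [hp x h.e_smul]; exact h2.symm⟩

/-- The submodules of a uniserial module are generated by the images of the generator under the
powers of `t`. -/
theorem exists_eq_span (h : D.IsInterval x a l) (N : Submodule A M) :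
    ∃ i ≤ l, N = Submodule.span A {D.t ^ i • x} := by
  classical
  have hex : ∃ i, D.t ^ i • x ∈ N := ⟨l, by rw [h.pow_smul]; exact N.zero_mem⟩
  refine ⟨Nat.find hex, Nat.find_min' hex (by rw [h.pow_smul]; exact N.zero_mem),
    le_antisymm (fun m hm => ?_) ?_⟩
  · obtain ⟨i, -, hi⟩ := h.exists_span_singleton_eq m
    have hiN : D.t ^ i • x ∈ N := by
      have := Submodule.mem_span_singleton_self (R := A) (D.t ^ i • x)
      rw [← hi] at this
      exact (Submodule.span_singleton_le_iff_mem m N).2 hm this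
    have hle := Nat.find_min' hex hiN
    have hm' : m ∈ Submodule.span A {D.t ^ i • x} := hi ▸ Submodule.mem_span_singleton_self m
    refine (Submodule.span_singleton_le_iff_mem _ _).2 (Submodule.mem_span_singleton.2
      ⟨D.t ^ (i - Nat.find hex), ?_⟩) hm'
    rw [← mul_smul, ← pow_add, Nat.sub_add_cancel hle]
  · exact (Submodule.span_singleton_le_iff_mem _ _).2 (Nat.find_spec hex)

theorem span_pow_antitone (x : M) {i j : ℕ} (hij : i ≤ j) :
    Submodule.span A {D.t ^ j • x} ≤ Submodule.span A {D.t ^ i • x} := by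
  refine (Submodule.span_singleton_le_iff_mem _ _).2 (Submodule.mem_span_singleton.2
      ⟨D.t ^ (j - i), ?_⟩)
  rw [← mul_smul, ← pow_add, Nat.sub_add_cancel hij]

theorem isUniserial (h : D.IsInterval x a l) : IsUniserial A M := by
  intro N N'
  obtain ⟨i, -, rfl⟩ := h.exists_eq_span N
  obtain ⟨j, -, rfl⟩ := h.exists_eq_span N'
  exact (le_total j i).imp (span_pow_antitone x) (span_pow_antitone x)

theorem subsingleton (h : D.IsInterval x a 0) : Subsingleton M := by
  have hx : x = 0 := by simpa using h.pow_smul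
  refine (Submodule.subsingleton_iff A).1 ((subsingleton_iff_bot_eq_top).1 ?_)
  rw [← h.span_eq, hx, Submodule.span_zero_singleton]

theorem ne_zero (h : D.IsInterval x a l) (hl : 0 < l) : x ≠ 0 := by
  simpa using h.pow_smul_ne 0 hl

theorem le (h : D.IsInterval x a l) : l ≤ c a := by
  rw [← h.pow_smul_eq_zero_iff, ← h.e_smul, ← mul_smul, D.pow_mul_e_eq_zero, zero_smul]

/-- A nonzero submodule of a uniserial module is essential. -/
theorem isEssentialSubmodule (h : D.IsInterval x a l) {N : Submodule A M} (hN : N ≠ ⊥) :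
    IsEssentialSubmodule N := by
  intro L hL
  rcases h.isUniserial N L with h' | h'
  · exact absurd (by rwa [inf_eq_left.2 h'] at hL) hN
  · rwa [inf_eq_right.2 h'] at hL

/-- The cyclic submodule generated by a homogeneous element. -/
theorem of_span {x : M} (hx : D.e a • x = x) (h0 : D.t ^ l • x = 0)
    (hne : ∀ i < l, D.t ^ i • x ≠ 0) :
    D.IsInterval (⟨x, Submodule.mem_span_singleton_self x⟩ : Submodule.span A {x}) a l where
  e_smul := Subtype.ext hx
  pow_smul := Subtype.ext h0
  pow_smul_ne i hi h := hne i hi (congrArg Subtype.val h)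
  span_eq := by
    refine (Submodule.eq_top_iff').2 fun ⟨m, hm⟩ => ?_
    obtain ⟨r, rfl⟩ := Submodule.mem_span_singleton.1 hm
    exact Submodule.mem_span_singleton.2 ⟨r, rfl⟩

theorem span_pow (h : D.IsInterval x a l) {i : ℕ} (hi : i ≤ l) :
    D.IsInterval (⟨D.t ^ i • x, Submodule.mem_span_singleton_self _⟩ :
      Submodule.span A {D.t ^ i • x}) (a + i) (l - i) := by
  refine of_span (D.e_smul_pow_smul h.e_smul i) ?_ fun j hj => ?_
  · rw [← mul_smul, ← pow_add, Nat.sub_add_cancel hi, h.pow_smul]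
  · rw [← mul_smul, ← pow_add]
    exact h.pow_smul_ne _ (by lia)

theorem quotient (h : D.IsInterval x a l) {i : ℕ} (hi : i ≤ l) :
    D.IsInterval (Submodule.Quotient.mk x : M ⧸ Submodule.span A {D.t ^ i • x}) a i where
  e_smul := by rw [← Submodule.Quotient.mk_smul, h.e_smul]
  pow_smul := by
    rw [← Submodule.Quotient.mk_smul, Submodule.Quotient.mk_eq_zero]
    exact Submodule.mem_span_singleton_self _
  pow_smul_ne j hj h0 := by
    rw [← Submodule.Quotient.mk_smul, Submodule.Quotient.mk_eq_zero] at h0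
    obtain ⟨r, hr⟩ := Submodule.mem_span_singleton.1 h0
    obtain ⟨p, hp⟩ := D.exists_smul_eq_aeval (a := a + i) r
    rw [hp _ (D.e_smul_pow_smul h.e_smul i)] at hr
    refine h.pow_smul_ne (l - 1) (by lia) ?_
    have hX : D.t ^ i = aeval D.t (X ^ i : K[X]) := by simp
    have hY : D.t ^ (l - 1 - j) = aeval D.t (X ^ (l - 1 - j) : K[X]) := by simp
    have : l - 1 = (l - 1 - j) + j := by lia
    rw [this, pow_add, mul_smul, ← hr, hX, hY, ← mul_smul, ← mul_smul, ← map_mul, ← map_mul,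
      show (X ^ (l - 1 - j) * p * X ^ i : K[X]) = p * X ^ (l - 1 - j + i) by ring, map_mul,
      mul_smul, aeval_X_pow, pow_smul_eq_zero_of_le (by lia) h.pow_smul, smul_zero]
  span_eq := by
    refine (Submodule.eq_top_iff').2 fun m => ?_
    obtain ⟨m, rfl⟩ := Submodule.Quotient.mk_surjective _ m
    obtain ⟨r, rfl⟩ := h.exists_smul_eq m
    exact Submodule.mem_span_singleton.2 ⟨r, rfl⟩

variable {N : Type*} [AddCommGroup N] [Module A N]

theorem smul_eq_zero_of (h : D.IsInterval x a l) {y : N} (hy : D.e a • y = y)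
    (hy0 : D.t ^ l • y = 0) {r : A} (hr : r • x = 0) : r • y = 0 := by
  -- `r` acts on `(x, y)` like a multiple of a power `t ^ i`, and `i = l` because `r • x = 0`
  obtain ⟨p, hp⟩ := D.exists_smul_eq_aeval (a := a) r
  have hp := hp (x, y) (Prod.ext h.e_smul hy)
  have hl : D.t ^ l • (x, y) = 0 := Prod.ext h.pow_smul hy0
  obtain ⟨i, hi, q, s, h1, h2⟩ := exists_aeval_smul hl p
  rw [← hp] at h1 h2
  have hx : D.t ^ i • x = 0 := by
    have := congrArg Prod.fst h2
    rwa [Prod.smul_fst, Prod.smul_fst, Prod.smul_fst, hr, smul_zero] at this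
  obtain rfl : i = l := le_antisymm hi (h.pow_smul_eq_zero_iff.1 hx)
  rw [hl, smul_zero] at h1
  exact congrArg Prod.snd h1

theorem exists_linearMap (h : D.IsInterval x a l) {y : N} (hy : D.e a • y = y)
    (hy0 : D.t ^ l • y = 0) : ∃ f : M →ₗ[A] N, f x = y := by
  set φ := LinearMap.toSpanSingleton A M x
  have hφ : Function.Surjective φ := fun m => h.exists_smul_eq m
  have hk : LinearMap.ker φ ≤ LinearMap.ker (LinearMap.toSpanSingleton A N y) := by
    intro r hr
    exact h.smul_eq_zero_of hy hy0 hr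
  refine ⟨(LinearMap.ker φ).liftQ _ hk ∘ₗ (φ.quotKerEquivOfSurjective hφ).symm, ?_⟩
  have h1 : x = φ.quotKerEquivOfSurjective hφ (Submodule.Quotient.mk 1) := by
    simp [φ]
  conv_lhs => rw [h1]
  simp

theorem exists_injective (h : D.IsInterval x a l) {y : N} (hy : D.e a • y = y)
    (hy0 : D.t ^ l • y = 0) (hne : ∀ i < l, D.t ^ i • y ≠ 0) :
    ∃ f : M →ₗ[A] N, f x = y ∧ Function.Injective f := by
  obtain ⟨f, rfl⟩ := h.exists_linearMap hy hy0
  refine ⟨f, rfl, LinearMap.ker_eq_bot.1 ?_⟩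
  obtain ⟨i, hi, hk⟩ := h.exists_eq_span (LinearMap.ker f)
  rcases hi.eq_or_lt with rfl | hi
  · rw [hk, h.pow_smul, Submodule.span_zero_singleton]
  · refine absurd ?_ (hne i hi)
    have : D.t ^ i • x ∈ LinearMap.ker f := hk ▸ Submodule.mem_span_singleton_self _
    simpa using this

theorem exists_equiv (h : D.IsInterval x a l) {y : N} (h' : D.IsInterval y a l) :
    ∃ f : M ≃ₗ[A] N, f x = y := by
  obtain ⟨f, hf, hi⟩ := h.exists_injective h'.e_smul h'.pow_smul h'.pow_smul_ne
  refine ⟨LinearEquiv.ofBijective f ⟨hi, fun m => ?_⟩, hf⟩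
  obtain ⟨r, rfl⟩ := h'.exists_smul_eq m
  exact ⟨r • x, by rw [map_smul, hf]⟩

theorem length_one_isSimpleModule (h : D.IsInterval x a 1) : IsSimpleModule A M := by
  have : Nontrivial M := ⟨x, 0, h.ne_zero one_pos⟩
  refine (isSimpleModule_iff A M).2 { eq_bot_or_eq_top := fun N => ?_ }
  obtain ⟨i, hi, rfl⟩ := h.exists_eq_span N
  interval_cases i
  · right; simp [h.span_eq]
  · left; rw [h.pow_smul, Submodule.span_zero_singleton]

theorem length_eq (h : D.IsInterval x a l) : Module.length A M = l := by
  induction l generalizing M a with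
  | zero => have := h.subsingleton; simp [Module.length_eq_zero]
  | succ l ih =>
    have h1 := ih (h.span_pow (i := 1) (by lia))
    have := (h.quotient (i := 1) (by lia)).length_one_isSimpleModule
    rw [Module.length_eq_add_of_exact (Submodule.subtype (Submodule.span A {D.t ^ 1 • x}))
      (Submodule.mkQ _) (Submodule.subtype_injective _) (Submodule.mkQ_surjective _)
      (LinearMap.exact_subtype_mkQ _), h1, Module.length_eq_one]
    push_cast; rfl

end IsInterval
end CyclicPresentation

/-! ### Projective and injective uniserial modules -/

theorem Module.Injective.of_leftInverse {A : Type u} [Ring A] {M J : Type v} [AddCommGroup M]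
    [Module A M] [AddCommGroup J] [Module A J] [hJ : Module.Injective A J] (i : M →ₗ[A] J)
    (p : J →ₗ[A] M) (h : ∀ m, p (i m) = m) : Module.Injective A M where
  out X Y _ _ _ _ f hf g := by
    obtain ⟨k, hk⟩ := hJ.out f hf (i ∘ₗ g)
    exact ⟨p ∘ₗ k, fun x => by simp [hk, h]⟩

/-- A module that is a direct summand in every larger module is injective. -/
theorem Module.Injective.of_forall_exists_leftInverse {A : Type u} [Ring A] {M : Type u}
    [AddCommGroup M] [Module A M]
    (h : ∀ (J : Type u) [AddCommGroup J] [Module A J] (i : M →ₗ[A] J), Function.Injective i →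
      ∃ p : J →ₗ[A] M, ∀ m, p (i m) = m) : Module.Injective A M := by
  let J : ModuleCat.{u} A := CategoryTheory.Injective.under (ModuleCat.of A M)
  let i : ModuleCat.of A M ⟶ J := CategoryTheory.Injective.ι (ModuleCat.of A M)
  have hi : Mono i := inferInstanceAs (Mono (CategoryTheory.Injective.ι _))
  obtain ⟨p, hp⟩ := h J i.hom ((ModuleCat.mono_iff_injective i).1 hi)
  have : Module.Injective A J := (Module.injective_iff_injective_object A _).2
    (inferInstanceAs (CategoryTheory.Injective (CategoryTheory.Injective.under _)))
  exact .of_leftInverse _ p hp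

namespace CyclicPresentation

variable {K : Type u} {A : Type v} [Field K] [Ring A] [Algebra K A] {n : ℕ} [NeZero n]
  {c : ZMod n → ℕ} (D : CyclicPresentation K A n c)
variable {M : Type w} [AddCommGroup M] [Module A M]

theorem isInterval_projective (a : ZMod n) :
    D.IsInterval (⟨D.e a, Submodule.mem_span_singleton_self _⟩ : Submodule.span A {D.e a})
      a (c a) :=
  .of_span (D.e_mul_self a) (D.pow_mul_e_eq_zero a) (D.pow_mul_e_ne_zero a)

theorem projective_span_e (a : ZMod n) : Module.Projective A (Submodule.span A {D.e a}) := by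
  refine Module.Projective.of_split (Submodule.subtype _)
    (LinearMap.toSpanSingleton A (Submodule.span A {D.e a})
      ⟨D.e a, Submodule.mem_span_singleton_self _⟩) (LinearMap.ext fun ⟨x, hx⟩ => ?_)
  obtain ⟨r, rfl⟩ := Submodule.mem_span_singleton.1 hx
  exact Subtype.ext (by simp [mul_assoc, D.e_mul_self])

variable {D}

theorem IsInterval.projective {x : M} {a : ZMod n} (h : D.IsInterval x a (c a)) :
    Module.Projective A M := by
  obtain ⟨f, -⟩ := (D.isInterval_projective a).exists_equiv h
  have := D.projective_span_e a
  exact .of_equiv f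

/-- If `t ^ l` kills `e (a - 1) • M`, then a uniserial submodule of `M` with top at `a` and of
length `l` is a direct summand. For a functional `g` that is `1` on the socle and factors through
the idempotent of the socle, the largest submodule in the kernel of `g` is a complement. -/
theorem exists_isCompl_span {x : M} {a : ZMod n} {l : ℕ} (hl : 0 < l) (hx : D.e a • x = x)
    (h0 : D.t ^ l • x = 0) (hne : ∀ i < l, D.t ^ i • x ≠ 0)
    (hM : ∀ m : M, D.t ^ l • D.e (a - 1) • m = 0) :
    ∃ C, IsCompl (Submodule.span A {x}) C := by
  let _ : Module K M := Module.compHom M (algebraMap K A)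
  have : IsScalarTower K A M := ⟨fun k r m => by
    rw [Algebra.smul_def, mul_smul]; rfl⟩
  have : SMulCommClass K A M := ⟨fun k r m => by
    change algebraMap K A k • r • m = r • algebraMap K A k • m
    rw [← mul_smul, Algebra.commutes, mul_smul]⟩
  set b : ZMod n := a + (l - 1 : ℕ) with hb
  obtain ⟨f, hf⟩ := Module.Projective.exists_dual_eq_one K (hne (l - 1) (by lia))
  have hfb : f (D.e b • D.t ^ (l - 1) • x) = 1 := by rw [D.e_smul_pow_smul hx, hf]
  let C : Submodule A M :=
    { carrier := {m | ∀ r : A, f (D.e b • r • m) = 0}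
      add_mem' := fun h h' r => by rw [smul_add, smul_add, map_add, h, h', add_zero]
      zero_mem' := fun r => by simp
      smul_mem' := fun s m h r => by rw [← mul_smul r]; exact h _ }
  -- only the powers of `t` below `l` matter in the definition of `C`
  have hC : ∀ m : M, (∀ j < l, f (D.e b • D.t ^ j • m) = 0) → m ∈ C := by
    intro m hm r
    induction D.mem_span r using Submodule.span_induction with
    | mem r h =>
      obtain ⟨i, d, rfl⟩ := h
      rw [← mul_smul, D.pow_mul_e, ← mul_assoc]
      by_cases hd : b = d + i
      · rw [← hd, D.e_mul_self, mul_smul]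
        rcases lt_or_ge i l with hi | hi
        · exact hm i hi
        · have h1 : b = a - 1 + (i - (i - l) : ℕ) := by
            rw [Nat.sub_sub_self hi, hb, Nat.cast_sub hl]; push_cast; ring
          have h2 : D.e b • D.t ^ i • m = D.t ^ l • D.e (a - 1) • D.t ^ (i - l) • m := by
            rw [← mul_smul, ← mul_smul, ← mul_smul, D.pow_mul_e, mul_assoc,
              ← pow_add, h1, Nat.sub_sub_self hi, Nat.add_sub_cancel' hi]
          rw [h2, hM, map_zero]
      · rw [D.e_mul_of_ne _ _ hd, zero_mul, zero_smul, map_zero]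
    | zero => simp
    | add r s _ _ hr hs => rw [add_smul, smul_add, map_add, hr, hs, add_zero]
    | smul k r _ hr => rw [smul_assoc, ← smul_comm k, map_smul, hr, smul_zero]
  have hI := IsInterval.of_span hx h0 hne
  refine ⟨C, ⟨?_, ?_⟩⟩
  · refine Submodule.disjoint_def.2 fun m hm hmC => ?_
    obtain ⟨i, hi, hspan⟩ := hI.exists_eq_span ((Submodule.span A {m}).comap (Submodule.subtype _))
    have hmem : (⟨m, hm⟩ : Submodule.span A {x}) ∈
        (Submodule.span A {m}).comap (Submodule.subtype _) :=
      Submodule.mem_span_singleton_self m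
    rcases hi.eq_or_lt with rfl | hi
    · rw [hspan, hI.pow_smul, Submodule.span_zero_singleton, Submodule.mem_bot] at hmem
      exact congrArg Subtype.val hmem
    · have : D.t ^ i • x ∈ Submodule.span A {m} := by
        have := hspan ▸ Submodule.mem_span_singleton_self (R := A)
          (D.t ^ i • (⟨x, Submodule.mem_span_singleton_self x⟩ : Submodule.span A {x}))
        exact this
      obtain ⟨r, hr⟩ := Submodule.mem_span_singleton.1 this
      have := hmC (D.t ^ (l - 1 - i) * r)
      rw [mul_smul, hr, ← mul_smul (D.t ^ _), ← pow_add, Nat.sub_add_cancel (by lia), hfb] at this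
      exact absurd this one_ne_zero
  · rw [codisjoint_iff, Submodule.eq_top_iff']
    intro m
    have hfk : ∀ (k : K) (j : ℕ) (y : M),
        f (D.e b • D.t ^ j • k • y) = k * f (D.e b • D.t ^ j • y) := fun k j y => by
      rw [← smul_comm k, ← smul_comm k, map_smul, smul_eq_mul]
    have key : ∀ s ≤ l, ∃ z ∈ Submodule.span A {x}, ∀ j < l, l - s ≤ j →
        f (D.e b • D.t ^ j • (m - z)) = 0 := by
      intro s
      induction s with
      | zero => exact fun _ => ⟨0, zero_mem _, fun j h1 h2 => by lia⟩
      | succ s ih =>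
        intro hs
        obtain ⟨z, hz, hz'⟩ := ih (by lia)
        refine ⟨z + f (D.e b • D.t ^ (l - (s + 1)) • (m - z)) • D.t ^ s • x, add_mem hz ?_, ?_⟩
        · exact Submodule.smul_of_tower_mem _ _
            (Submodule.smul_mem _ _ (Submodule.mem_span_singleton_self x))
        · intro j h1 h2
          rw [← sub_sub, smul_sub, smul_sub, map_sub, hfk, ← mul_smul (D.t ^ j), ← pow_add]
          rcases h2.eq_or_lt with rfl | h2
          · rw [show l - (s + 1) + s = l - 1 by lia, hfb, mul_one, sub_self]
          · rw [hz' j h1 (by lia), pow_smul_eq_zero_of_le (by lia) h0]; simp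
    obtain ⟨z, hz, hz'⟩ := key l le_rfl
    exact Submodule.mem_sup.2 ⟨z, hz, m - z, hC _ fun j hj => hz' j hj (by lia),
      add_sub_cancel _ _⟩

theorem exists_t_pow_eq_zero (D : CyclicPresentation K A n c) : ∃ l, D.t ^ l = 0 := by
  refine ⟨∑ a, c a, ?_⟩
  rw [← mul_one (D.t ^ _), ← D.sum_e, Finset.mul_sum]
  refine Finset.sum_eq_zero fun a _ => ?_
  obtain ⟨j, hj⟩ := Nat.exists_eq_add_of_le (Finset.single_le_sum (f := c)
    (fun _ _ => Nat.zero_le _) (Finset.mem_univ a))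
  rw [hj, add_comm, pow_add, mul_assoc, D.pow_mul_e_eq_zero, mul_zero]

theorem isUniserial_of_isIndecomposableModule (D : CyclicPresentation K A n c)
    (hM : IsIndecomposableModule A M) : IsUniserial A M := by
  classical
  have := hM.1
  have hex : ∃ l, ∀ m : M, D.t ^ l • m = 0 := by
    obtain ⟨l, hl⟩ := D.exists_t_pow_eq_zero
    exact ⟨l, fun m => by rw [hl, zero_smul]⟩
  obtain ⟨l, hl, hmin⟩ : ∃ l, (∀ m : M, D.t ^ l • m = 0) ∧ ∀ i < l, ¬ ∀ m : M, D.t ^ i • m = 0 :=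
    ⟨Nat.find hex, Nat.find_spec hex, fun i hi => Nat.find_min hex hi⟩
  have hl0 : 0 < l := by
    by_contra! h0
    obtain ⟨m, hm⟩ := exists_ne (0 : M)
    exact hm (by simpa [Nat.le_zero.1 h0] using hl m)
  obtain ⟨a, m, hm⟩ : ∃ a, ∃ m : M, D.t ^ (l - 1) • D.e a • m ≠ 0 := by
    by_contra! h
    refine hmin (l - 1) (by lia) fun m => ?_
    rw [D.eq_sum_e_smul m, Finset.smul_sum]
    exact Finset.sum_eq_zero fun a _ => h a m
  have hx := D.e_smul_e_smul a m
  have hne : ∀ i < l, D.t ^ i • D.e a • m ≠ 0 := fun i hi h =>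
    hm (pow_smul_eq_zero_of_le (by lia) h)
  obtain ⟨C, hC⟩ := exists_isCompl_span hl0 hx (hl _) hne fun m => hl _
  rcases hM.2 _ _ hC with h | rfl
  · refine absurd ?_ (hne 0 hl0)
    simpa using h
  · refine IsInterval.isUniserial (D := D) (x := D.e a • m) (a := a) (l := l)
      ⟨hx, hl _, hne, by simpa using hC.sup_eq_top⟩

theorem IsInterval.injective {A : Type u} [Ring A] [Algebra K A]
    {D : CyclicPresentation K A n c} {M : Type u} [AddCommGroup M] [Module A M] {x : M}
    {a : ZMod n} {l : ℕ} (h : D.IsInterval x a l) (hl : c (a - 1) ≤ l) :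
    Module.Injective A M := by
  refine .of_forall_exists_leftInverse fun J _ _ i hi => ?_
  rcases Nat.eq_zero_or_pos l with rfl | hl0
  · have := h.subsingleton
    exact ⟨0, fun m => Subsingleton.elim _ _⟩
  have hmap : ∀ j, D.t ^ j • i x = i (D.t ^ j • x) := fun j => (map_smul _ _ _).symm
  obtain ⟨C, hC⟩ := exists_isCompl_span (D := D) (x := i x) (a := a) (l := l) hl0
    (by rw [← map_smul, h.e_smul]) (by rw [hmap, h.pow_smul, map_zero])
    (fun j hj => by rw [hmap]; simpa using (map_ne_zero_iff i hi).2 (h.pow_smul_ne j hj))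
    (fun m => by
      rw [← mul_smul, ← Nat.sub_add_cancel hl, pow_add, mul_assoc, D.pow_mul_e_eq_zero]; simp)
  have hr : Submodule.span A {i x} = LinearMap.range i := by
    rw [LinearMap.range_eq_map, ← h.span_eq, Submodule.map_span, Set.image_singleton]
  rw [hr] at hC
  refine ⟨(LinearEquiv.ofInjective i hi).symm ∘ₗ Submodule.projectionOnto _ C hC, fun m => ?_⟩
  have : Submodule.projectionOnto _ C hC (i m) = LinearEquiv.ofInjective i hi m :=
    Submodule.projectionOnto_apply_left hC (LinearEquiv.ofInjective i hi m)
  simp [this]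

end CyclicPresentation

/-! ### Minimal injective resolutions with projective terms -/

section Resolutions

variable {A : Type u} [Ring A]

variable (A) in
/-- `M` has a minimal injective resolution whose first `k` terms are projective, that is, the
dominant dimension of `M` is at least `k`. -/
def HasProjectiveInjectiveTerms (M : Type u) [AddCommGroup M] [Module A M] (k : ℕ) : Prop :=
  ∃ (I : ℕ → ModuleCat.{u} A) (ε : ModuleCat.of A M →ₗ[A] I 0)
    (d : ∀ i, I i →ₗ[A] I (i + 1)), IsMinimalInjectiveResolution (ModuleCat.of A M) I ε d ∧
      ∀ i < k, Module.Projective A (I i)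

variable {M N J : Type u} [AddCommGroup M] [Module A M] [AddCommGroup N] [Module A N]
  [AddCommGroup J] [Module A J]

namespace HasProjectiveInjectiveTerms

theorem mono {k l : ℕ} (hkl : k ≤ l) (h : HasProjectiveInjectiveTerms A M l) :
    HasProjectiveInjectiveTerms A M k := by
  obtain ⟨I, ε, d, h1, h2⟩ := h
  exact ⟨I, ε, d, h1, fun i hi => h2 i (hi.trans_le hkl)⟩

theorem of_subsingleton [Subsingleton M] (k : ℕ) : HasProjectiveInjectiveTerms A M k := by
  have hb : ∀ S : Submodule A PUnit.{u + 1}, S = ⊥ := fun S => Subsingleton.elim _ _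
  refine ⟨fun _ => ModuleCat.of A PUnit, 0, fun _ => 0, ⟨fun i => ?_, ?_, ?_, ?_, ?_, ?_⟩,
    fun i _ => ?_⟩
  · exact ⟨fun X Y _ _ _ _ f _ g => ⟨0, fun x => rfl⟩⟩
  · exact Subsingleton.elim _ _
  · exact Subsingleton.elim _ _
  · exact fun i => Subsingleton.elim _ _
  · exact fun L _ => hb L
  · exact fun i L _ => hb L
  · exact inferInstanceAs (Module.Projective A PUnit.{u + 1})

theorem of_equiv (e : M ≃ₗ[A] N) {k : ℕ} (h : HasProjectiveInjectiveTerms A M k) :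
    HasProjectiveInjectiveTerms A N k := by
  obtain ⟨I, ε, d, h1, h2⟩ := h
  have hr : LinearMap.range (ε ∘ₗ e.symm.toLinearMap) = LinearMap.range ε :=
    LinearMap.range_comp_of_range_eq_top _ (LinearEquiv.range _)
  refine ⟨I, ε ∘ₗ e.symm.toLinearMap, d, ⟨h1.injective, ?_, ?_, h1.exact_succ, ?_,
    h1.essential_succ⟩, h2⟩
  · exact LinearMap.ker_eq_bot.2 ((LinearMap.ker_eq_bot.1 h1.ker_eq_bot).comp e.symm.injective)
  · exact hr.trans h1.exact_zero
  · rw [hr]; exact h1.essential_zero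

/-- Splicing: an injective envelope `M → J` and a minimal injective resolution of its cokernel
form a minimal injective resolution of `M`. -/
theorem succ {k : ℕ} [hJ : Module.Injective A J] [hJ' : Module.Projective A J] (f : M →ₗ[A] J)
    (g : J →ₗ[A] N) (hf : Function.Injective f) (hg : Function.Surjective g)
    (hfg : LinearMap.range f = LinearMap.ker g) (hess : IsEssentialSubmodule (LinearMap.range f))
    (h : HasProjectiveInjectiveTerms A N k) : HasProjectiveInjectiveTerms A M (k + 1) := by
  obtain ⟨I, ε, d, h1, h2⟩ := h
  have hr : LinearMap.range (ε ∘ₗ g) = LinearMap.range ε :=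
    LinearMap.range_comp_of_range_eq_top _ (LinearMap.range_eq_top.2 hg)
  refine ⟨fun | 0 => ModuleCat.of A J | i + 1 => I i, f, fun | 0 => ε ∘ₗ g | i + 1 => d i,
    ⟨?_, ?_, ?_, ?_, ?_, ?_⟩, ?_⟩
  · rintro (_ | i)
    exacts [hJ, h1.injective i]
  · exact LinearMap.ker_eq_bot.2 hf
  · exact hfg.trans (LinearMap.ker_comp_of_ker_eq_bot g h1.ker_eq_bot).symm
  · rintro (_ | i)
    exacts [hr.trans h1.exact_zero, h1.exact_succ i]
  · exact hess
  · rintro (_ | i)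
    · change IsEssentialSubmodule (LinearMap.range (ε ∘ₗ g))
      rw [hr]; exact h1.essential_zero
    · exact h1.essential_succ i
  · rintro (_ | i) hi
    exacts [hJ', h2 i (by lia)]

theorem of_injective [Module.Injective A M] : HasProjectiveInjectiveTerms A M 0 := by
  obtain ⟨I, ε, d, h1, h2⟩ := of_subsingleton (A := A) (M := PUnit.{u + 1}) 0
  refine ⟨fun | 0 => ModuleCat.of A M | i + 1 => I i, LinearMap.id, fun | 0 => 0 | i + 1 => d i,
    ⟨?_, ?_, ?_, ?_, ?_, ?_⟩, ?_⟩
  · rintro (_ | i)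
    exacts [inferInstanceAs (Module.Injective A M), h1.injective i]
  · exact LinearMap.ker_id
  · exact LinearMap.range_id.trans LinearMap.ker_zero.symm
  · rintro (_ | i)
    · refine Eq.trans ?_ h1.exact_zero
      rw [LinearMap.range_zero, eq_comm, LinearMap.range_eq_bot]
      exact LinearMap.ext fun x => by rw [Subsingleton.elim x 0, map_zero, map_zero]
    · exact h1.exact_succ i
  · intro L hL
    rwa [LinearMap.range_id, top_inf_eq] at hL
  · rintro (_ | i)
    · have := h1.essential_zero
      have h0 : LinearMap.range ε = LinearMap.range (0 : M →ₗ[A] I 0) := by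
        rw [LinearMap.range_zero, LinearMap.range_eq_bot]
        exact LinearMap.ext fun x => by rw [Subsingleton.elim x 0, map_zero, map_zero]
      rwa [h0] at this
    · exact h1.essential_succ i
  · rintro i hi
    exact absurd hi (by lia)

theorem of_injective_of_projective [Module.Injective A M] [Module.Projective A M] (k : ℕ) :
    HasProjectiveInjectiveTerms A M k := by
  refine mono (Nat.le_succ k) (succ (LinearMap.id : M →ₗ[A] M) (0 : M →ₗ[A] PUnit.{u + 1})
    Function.injective_id (fun x => ⟨0, rfl⟩) (LinearMap.range_id.trans LinearMap.ker_zero.symm)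
    (fun L hL => ?_) (of_subsingleton k))
  rwa [LinearMap.range_id, top_inf_eq] at hL

end HasProjectiveInjectiveTerms

theorem isEssentialSubmodule_iff {M : Type v} [AddCommGroup M] [Module A M] {N : Submodule A M} :
    IsEssentialSubmodule N ↔ ∀ m : M, m ≠ 0 → ∃ r : A, r • m ≠ 0 ∧ r • m ∈ N := by
  constructor
  · intro h m hm
    by_contra! h0
    refine hm ((Submodule.span_singleton_eq_bot (R := A)).1 (h _ (eq_bot_iff.2 ?_)))
    rintro x ⟨hx, hx'⟩
    obtain ⟨r, rfl⟩ := Submodule.mem_span_singleton.1 hx'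
    by_contra hr
    exact h0 r hr hx
  · intro h L hL
    refine eq_bot_iff.2 fun m hm => ?_
    by_contra hm0
    obtain ⟨r, hr, hr'⟩ := h m hm0
    have : r • m ∈ N ⊓ L := ⟨hr', L.smul_mem r hm⟩
    rw [hL] at this
    exact hr this

/-- To move `m ≠ 0` into the product by a scalar, one coordinate after the other is treated. -/
theorem IsEssentialSubmodule.pi {ι : Type*} [Finite ι] {M : ι → Type u}
    [∀ i, AddCommGroup (M i)] [∀ i, Module A (M i)] {N : ∀ i, Submodule A (M i)}
    (h : ∀ i, IsEssentialSubmodule (N i)) : IsEssentialSubmodule (Submodule.pi Set.univ N) := by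
  classical
  have := Fintype.ofFinite ι
  rw [isEssentialSubmodule_iff]
  intro m hm
  have key : ∀ s : Finset ι, ∃ r : A, r • m ≠ 0 ∧ ∀ i ∈ s, r • m i ∈ N i := by
    intro s
    induction s using Finset.induction_on with
    | empty => exact ⟨1, by simpa using hm, by simp⟩
    | insert i s _ ih =>
      obtain ⟨r, hr, hr'⟩ := ih
      by_cases h0 : r • m i = 0
      · refine ⟨r, hr, fun j hj => ?_⟩
        rcases Finset.mem_insert.1 hj with rfl | hj
        · rw [h0]; exact zero_mem _
        · exact hr' j hj
      · obtain ⟨s, hs, hs'⟩ := isEssentialSubmodule_iff.1 (h i) _ h0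
        refine ⟨s * r, fun h => hs ?_, fun j hj => ?_⟩
        · rw [← mul_smul]; exact congrFun h i
        · rw [mul_smul]
          rcases Finset.mem_insert.1 hj with rfl | hj
          · exact hs'
          · exact Submodule.smul_mem _ _ (hr' j hj)
  obtain ⟨r, hr, hr'⟩ := key Finset.univ
  exact ⟨r, hr, fun i _ => hr' i (Finset.mem_univ i)⟩

theorem LinearMap.range_piMap {ι : Type*} {M N : ι → Type u}
    [∀ i, AddCommGroup (M i)] [∀ i, Module A (M i)] [∀ i, AddCommGroup (N i)]
    [∀ i, Module A (N i)] (f : ∀ i, M i →ₗ[A] N i) :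
    LinearMap.range (LinearMap.piMap f) = Submodule.pi Set.univ fun i => LinearMap.range (f i) := by
  ext y
  constructor
  · rintro ⟨x, rfl⟩ i -
    exact ⟨x i, rfl⟩
  · intro h
    choose x hx using fun i => h i (Set.mem_univ i)
    exact ⟨x, funext hx⟩

theorem LinearMap.ker_piMap {ι : Type*} {M N : ι → Type u}
    [∀ i, AddCommGroup (M i)] [∀ i, Module A (M i)] [∀ i, AddCommGroup (N i)]
    [∀ i, Module A (N i)] (f : ∀ i, M i →ₗ[A] N i) :
    LinearMap.ker (LinearMap.piMap f) = Submodule.pi Set.univ fun i => LinearMap.ker (f i) := by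
  ext y
  simp [funext_iff, Submodule.mem_pi]

theorem HasProjectiveInjectiveTerms.pi {ι : Type} [Finite ι] {M : ι → Type u}
    [∀ i, AddCommGroup (M i)] [∀ i, Module A (M i)] {k : ℕ}
    (h : ∀ i, HasProjectiveInjectiveTerms A (M i) k) :
    HasProjectiveInjectiveTerms A (∀ i, M i) k := by
  classical
  choose I ε d h1 h2 using h
  refine ⟨fun i => ModuleCat.of A (∀ a, I a i), LinearMap.piMap ε,
    fun i => LinearMap.piMap fun a => d a i, ⟨fun i => ?_, ?_, ?_, fun i => ?_, ?_, fun i => ?_⟩,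
    fun i hi => ?_⟩
  · have := fun a => (h1 a).injective i
    exact inferInstanceAs (Module.Injective A (∀ a, I a i))
  · refine (LinearMap.ker_piMap ε).trans ?_
    simp only [(h1 _).ker_eq_bot]
    exact Submodule.pi_univ_bot
  · refine (LinearMap.range_piMap ε).trans (Eq.trans ?_ (LinearMap.ker_piMap _).symm)
    exact congrArg _ (funext fun a => (h1 a).exact_zero)
  · refine (LinearMap.range_piMap _).trans (Eq.trans ?_ (LinearMap.ker_piMap _).symm)
    exact congrArg _ (funext fun a => (h1 a).exact_succ i)
  · have := IsEssentialSubmodule.pi fun a => (h1 a).essential_zero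
    rwa [← LinearMap.range_piMap] at this
  · have := IsEssentialSubmodule.pi fun a => (h1 a).essential_succ i
    rwa [← LinearMap.range_piMap] at this
  · have := Fintype.ofFinite ι
    have := fun a => h2 a i hi
    exact .of_equiv (DFinsupp.linearEquivFunOnFintype (R := A) (M := fun a => I a i))

/-! ### Projective dimension along exact sequences -/

theorem hasProjectiveDimensionLE_succ_of_surjective {d : ℕ} (f : M →ₗ[A] N)
    (hf : Function.Surjective f) [Module.Projective A M]
    (h : HasProjectiveDimensionLE (ModuleCat.of A (LinearMap.ker f)) d) :
    HasProjectiveDimensionLE (ModuleCat.of A N) (d + 1) :=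
  ((LinearMap.shortExact_shortComplexKer hf).hasProjectiveDimensionLT_X₃_iff d
    (inferInstanceAs (Projective (ModuleCat.of A M)))).2 h

theorem hasProjectiveDimensionLE_ker_of_surjective {d : ℕ} (f : M →ₗ[A] N)
    (hf : Function.Surjective f) [Module.Projective A M]
    (h : HasProjectiveDimensionLE (ModuleCat.of A N) (d + 1)) :
    HasProjectiveDimensionLE (ModuleCat.of A (LinearMap.ker f)) d :=
  ((LinearMap.shortExact_shortComplexKer hf).hasProjectiveDimensionLT_X₃_iff d
    (inferInstanceAs (Projective (ModuleCat.of A M)))).1 h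

theorem hasProjectiveDimensionLE_of_equiv {d : ℕ} (e : M ≃ₗ[A] N)
    (h : HasProjectiveDimensionLE (ModuleCat.of A M) d) :
    HasProjectiveDimensionLE (ModuleCat.of A N) d :=
  hasProjectiveDimensionLT_of_iso e.toModuleIso _

theorem hasProjectiveDimensionLE_of_submodule {d : ℕ} (L : Submodule A M)
    (h : HasProjectiveDimensionLE (ModuleCat.of A L) d)
    (h' : HasProjectiveDimensionLE (ModuleCat.of A (M ⧸ L)) d) :
    HasProjectiveDimensionLE (ModuleCat.of A M) d := by
  refine (LinearMap.shortExact_shortComplexKer L.mkQ_surjective).hasProjectiveDimensionLT_X₂ _ ?_ h'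
  exact hasProjectiveDimensionLE_of_equiv (LinearEquiv.ofEq _ _ L.ker_mkQ.symm) h

theorem hasProjectiveDimensionLE_mono {d e : ℕ} (hde : d ≤ e)
    (h : HasProjectiveDimensionLE (ModuleCat.of A M) d) :
    HasProjectiveDimensionLE (ModuleCat.of A M) e :=
  hasProjectiveDimensionLT_of_ge _ (d + 1) _ (by lia)

theorem module_projective_iff_hasProjectiveDimensionLE_zero :
    Module.Projective A M ↔ HasProjectiveDimensionLE (ModuleCat.of A M) 0 := by
  rw [← projective_iff_hasProjectiveDimensionLE_zero, IsProjective.iff_projective]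

/-- Let the terms `I 0, …, I k` of an injective resolution of `M` be projective, and let the image
of `I k → I (k + 1)` have projective dimension at most `k`. The image of `I 0 → I 1` is a `k`-th
syzygy of it and thus projective, so `M` is a direct summand of `I 0`. -/
theorem IsMinimalInjectiveResolution.injective_of_hasProjectiveDimensionLE
    {M : ModuleCat.{u} A} {I : ℕ → ModuleCat.{u} A} {ε : M →ₗ[A] I 0}
    {d : ∀ i, I i →ₗ[A] I (i + 1)} (h : IsMinimalInjectiveResolution M I ε d) (k : ℕ)
    (hP : ∀ i ≤ k, Module.Projective A (I i))
    (hk : HasProjectiveDimensionLE (ModuleCat.of A (LinearMap.range (d k))) k) :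
    Module.Injective A M := by
  induction k with
  | succ k ih =>
    refine ih (fun i hi => hP i (by lia)) ?_
    have := hP (k + 1) le_rfl
    refine hasProjectiveDimensionLE_of_equiv (LinearEquiv.ofEq _ _ ?_)
      (hasProjectiveDimensionLE_ker_of_surjective (d (k + 1)).rangeRestrict
        (LinearMap.surjective_rangeRestrict _) hk)
    rw [LinearMap.ker_rangeRestrict, h.exact_succ]
  | zero =>
    have := module_projective_iff_hasProjectiveDimensionLE_zero.2 hk
    obtain ⟨s, hs⟩ := Module.projective_lifting_property (d 0).rangeRestrict LinearMap.id
      (LinearMap.surjective_rangeRestrict _)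
    have hs : ∀ y, (d 0).rangeRestrict (s y) = y := fun y => LinearMap.congr_fun hs y
    -- `z ↦ z - s (d z)` is a projection of `I 0` onto the image of `M`
    have hmem : ∀ z, z - s ((d 0).rangeRestrict z) ∈ LinearMap.range ε := by
      intro z
      rw [h.exact_zero, ← LinearMap.ker_rangeRestrict, LinearMap.mem_ker, map_sub, hs, sub_self]
    have := h.injective 0
    refine .of_leftInverse ε ((LinearEquiv.ofInjective ε (LinearMap.ker_eq_bot.1
      h.ker_eq_bot)).symm ∘ₗ ((LinearMap.id - s ∘ₗ (d 0).rangeRestrict).codRestrict _ hmem))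
      fun m => ?_
    rw [LinearMap.comp_apply, LinearEquiv.coe_coe, LinearEquiv.symm_apply_eq]
    have h0 : (d 0).rangeRestrict (ε m) = 0 := by
      rw [← LinearMap.mem_ker, LinearMap.ker_rangeRestrict, ← h.exact_zero]
      exact ⟨m, rfl⟩
    exact Subtype.ext (by simp [h0])

end Resolutions

namespace CyclicPresentation

variable {K : Type u} {A : Type u} [Field K] [Ring A] [Algebra K A] {n : ℕ} [NeZero n]
  {c : ZMod n → ℕ} {D : CyclicPresentation K A n c}

/-! ### Finitely generated modules -/

theorem finite (D : CyclicPresentation K A n c) : Module.Finite K A := by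
  obtain ⟨l, hl⟩ := D.exists_t_pow_eq_zero
  refine ⟨Submodule.fg_def.2 ⟨Set.range fun p : Fin l × ZMod n => D.t ^ (p.1 : ℕ) * D.e p.2,
    Set.finite_range _, eq_top_iff.2 fun x _ => ?_⟩⟩
  refine Submodule.span_le.2 ?_ (D.mem_span x)
  rintro _ ⟨i, a, rfl⟩
  rcases lt_or_ge i l with hi | hi
  · exact Submodule.subset_span ⟨(⟨i, hi⟩, a), rfl⟩
  · rw [← Nat.sub_add_cancel hi, pow_add, hl, mul_zero, zero_mul]
    exact zero_mem _

theorem exists_isInterval (D : CyclicPresentation K A n c) {M : Type w} [AddCommGroup M]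
    [Module A M] {x : M} {a : ZMod n} (hx : D.e a • x = x)
    (hs : Submodule.span A {x} = ⊤) : ∃ l, D.IsInterval x a l := by
  classical
  have hex : ∃ l, D.t ^ l • x = 0 := by
    obtain ⟨l, hl⟩ := D.exists_t_pow_eq_zero
    exact ⟨l, by rw [hl, zero_smul]⟩
  exact ⟨Nat.find hex, hx, Nat.find_spec hex, fun i hi => Nat.find_min hex hi, hs⟩

theorem exists_isInterval_of_isSimpleModule (D : CyclicPresentation K A n c) (M : Type w)
    [AddCommGroup M] [Module A M] [IsSimpleModule A M] :
    ∃ (a : ZMod n) (x : M), D.IsInterval x a 1 := by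
  have := IsSimpleModule.nontrivial A M
  obtain ⟨m, hm⟩ := exists_ne (0 : M)
  obtain ⟨a, ha⟩ := D.exists_e_smul_ne_zero hm
  obtain ⟨l, hl⟩ := D.exists_isInterval (D.e_smul_e_smul a m)
    ((eq_bot_or_eq_top (Submodule.span A {D.e a • m})).resolve_left
      (fun h => ha (Submodule.span_singleton_eq_bot.1 h)))
  obtain rfl : l = 1 := by
    have := hl.length_eq
    rw [Module.length_eq_one] at this
    exact_mod_cast this.symm
  exact ⟨a, _, hl⟩

/-- An essential extension of a finitely generated module is finitely generated: it has the same
socle, so the kernel of `t` on it is finite dimensional, and `t` is nilpotent. -/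
theorem finite_of_isEssentialSubmodule (D : CyclicPresentation K A n c) {M : Type u}
    [AddCommGroup M] [Module A M] {N : Submodule A M} (hN : IsEssentialSubmodule N)
    [Module.Finite A N] : Module.Finite A M := by
  let _ : Module K M := Module.compHom M (algebraMap K A)
  have : IsScalarTower K A M := ⟨fun k r m => by
    rw [Algebra.smul_def, mul_smul]; rfl⟩
  have : SMulCommClass K A M := ⟨fun k r m => by
    change algebraMap K A k • r • m = r • algebraMap K A k • m
    rw [← mul_smul, Algebra.commutes, mul_smul]⟩
  have := D.finite
  have hNK : Module.Finite K N := Module.Finite.trans A N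
  let T : M →ₗ[K] M := DistribSMul.toLinearMap K M D.t
  have hT : ∀ (j : ℕ) (m : M), (T ^ j) m = D.t ^ j • m := by
    intro j
    induction j with
    | zero => simp
    | succ j ih => intro m; rw [pow_succ', Module.End.mul_apply, ih, pow_succ', mul_smul]; rfl
  have hker : LinearMap.ker T ≤ N.restrictScalars K := by
    intro m hm
    rw [Submodule.restrictScalars_mem, D.eq_sum_e_smul m]
    refine sum_mem fun a _ => ?_
    have h0 : D.t ^ 1 • D.e a • m = 0 := by
      have hm : D.t • m = 0 := hm
      rw [pow_one, ← mul_smul, D.t_mul_e, mul_smul, hm, smul_zero]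
    by_contra hmem
    refine hmem (?_ : D.e a • m ∈ N)
    have hbot := hN (Submodule.span A {D.e a • m}) (eq_bot_iff.2 ?_)
    · rw [Submodule.span_singleton_eq_bot.1 hbot]
      exact zero_mem _
    · rintro z ⟨hz, hz'⟩
      have hI := IsInterval.of_span (D := D) (l := 1) (D.e_smul_e_smul a m) h0 (fun i hi h => by
        obtain rfl : i = 0 := by lia
        rw [pow_zero, one_smul] at h
        exact hmem (by rw [h]; exact zero_mem _))
      have := hI.length_one_isSimpleModule
      rcases eq_bot_or_eq_top (N.comap (Submodule.span A {D.e a • m}).subtype) with h | h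
      · have : (⟨z, hz'⟩ : Submodule.span A {D.e a • m}) ∈
          N.comap (Submodule.span A {D.e a • m}).subtype := hz
        rw [h] at this
        exact congrArg Subtype.val this
      · have : (⟨D.e a • m, Submodule.mem_span_singleton_self _⟩ :
          Submodule.span A {D.e a • m}) ∈ N.comap (Submodule.span A {D.e a • m}).subtype :=
          h ▸ Submodule.mem_top
        exact absurd this hmem
  have hN' : IsNoetherian K (N.restrictScalars K) :=
    inferInstanceAs (IsNoetherian K N)
  have h1 : IsNoetherian K (LinearMap.ker T) := isNoetherian_of_le hker
  have hj : ∀ j, IsNoetherian K (LinearMap.ker (T ^ j)) := by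
    intro j
    induction j with
    | zero =>
      rw [pow_zero, Module.End.one_eq_id, LinearMap.ker_id]
      infer_instance
    | succ j ih =>
      have hle : LinearMap.ker T ≤ LinearMap.ker (T ^ (j + 1)) := by
        rw [pow_succ]; exact LinearMap.ker_le_ker_comp _ _
      refine isNoetherian_of_range_eq_ker (Submodule.inclusion hle)
        (T.restrict (p := LinearMap.ker (T ^ (j + 1))) (q := LinearMap.ker (T ^ j)) ?_) ?_
      · intro m hm
        rwa [LinearMap.mem_ker, ← Module.End.mul_apply, ← pow_succ]
      · ext ⟨m, hm⟩
        rw [Submodule.range_inclusion]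
        simp [Subtype.ext_iff]
  obtain ⟨l, hl⟩ := D.exists_t_pow_eq_zero
  have htop : LinearMap.ker (T ^ l) = ⊤ := by
    refine eq_top_iff.2 fun m _ => ?_
    rw [LinearMap.mem_ker, hT, hl, zero_smul]
  have := hj l
  rw [htop] at this
  have : Module.Finite K M := Module.Finite.equiv (Submodule.topEquiv (R := K) (M := M))
  exact Module.Finite.of_restrictScalars_finite K A M

/-! ### Syzygies and cosyzygies of uniserial modules -/

/-- The uniserial modules with top at `a` and of length `l` have projective dimension at most
`d`. -/
def ProjectiveDimensionLE (D : CyclicPresentation K A n c) (a : ZMod n) (l d : ℕ) : Prop :=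
  ∀ ⦃M : Type u⦄ [AddCommGroup M] [Module A M] ⦃x : M⦄, D.IsInterval x a l →
    HasProjectiveDimensionLE (ModuleCat.of A M) d

/-- The uniserial modules with top at `a` and of length `l` have a minimal injective resolution
whose first `k` terms are projective. -/
def ProjectiveInjectiveTerms (D : CyclicPresentation K A n c) (a : ZMod n) (l k : ℕ) : Prop :=
  ∀ ⦃M : Type u⦄ [AddCommGroup M] [Module A M] ⦃x : M⦄, D.IsInterval x a l →
    HasProjectiveInjectiveTerms A M k

theorem ProjectiveDimensionLE.mono {a : ZMod n} {l d e : ℕ} (h : D.ProjectiveDimensionLE a l d)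
    (hde : d ≤ e) : D.ProjectiveDimensionLE a l e :=
  fun _ _ _ _ hx => hasProjectiveDimensionLE_mono hde (h hx)

theorem projectiveDimensionLE_zero {a : ZMod n} {l : ℕ} (hl : l = c a) :
    D.ProjectiveDimensionLE a l 0 := by
  subst hl
  exact fun _ _ _ _ hx => module_projective_iff_hasProjectiveDimensionLE_zero.1 hx.projective

/-- The syzygy of the uniserial module with top at `a` and of length `l` has its top at `a + l`
and length `c a - l`. -/
theorem ProjectiveDimensionLE.succ {a : ZMod n} {l d : ℕ}
    (h : D.ProjectiveDimensionLE (a + l) (c a - l) d) : D.ProjectiveDimensionLE a l (d + 1) := by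
  intro M _ _ x hx
  have hP := D.isInterval_projective a
  have := D.projective_span_e a
  obtain ⟨f, -⟩ := (hP.quotient hx.le).exists_equiv hx
  refine hasProjectiveDimensionLE_of_equiv f ?_
  refine hasProjectiveDimensionLE_succ_of_surjective (Submodule.mkQ _)
    (Submodule.mkQ_surjective _) ?_
  exact hasProjectiveDimensionLE_of_equiv (LinearEquiv.ofEq _ _ (Submodule.ker_mkQ _).symm)
    (h (hP.span_pow hx.le))

/-- A nonzero module of finite length is an extension of a simple module by a module of smaller
length, so the simple modules bound the projective dimensions. -/
theorem hasProjectiveDimensionLE_of_simple {d : ℕ}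
    (h : ∀ a, D.ProjectiveDimensionLE a 1 d)
    (M : Type u) [AddCommGroup M] [Module A M] [Module.Finite A M] :
    HasProjectiveDimensionLE (ModuleCat.of A M) d := by
  have := D.finite
  have : IsArtinianRing A := .of_finite K A
  have hM : IsFiniteLength A M := isFiniteLength_iff_isNoetherian_isArtinian.2
    ⟨inferInstance, inferInstance⟩
  induction hM with
  | of_subsingleton =>
    exact hasProjectiveDimensionLE_mono (Nat.zero_le d)
      (module_projective_iff_hasProjectiveDimensionLE_zero.1 inferInstance)
  | @of_simple_quotient M _ _ N _ _ ih =>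
    obtain ⟨a, x, hx⟩ := D.exists_isInterval_of_isSimpleModule (M ⧸ N)
    exact hasProjectiveDimensionLE_of_submodule N ih (h a hx)

theorem projectiveInjectiveTerms_zero {a : ZMod n} {l : ℕ} (h : c (a - 1) ≤ l) :
    D.ProjectiveInjectiveTerms a l 0 := fun _ _ _ _ hx => by
  have := hx.injective h
  exact .of_injective

theorem projectiveInjectiveTerms_of_le {a : ZMod n} (h : c (a - 1) ≤ c a) (k : ℕ) :
    D.ProjectiveInjectiveTerms a (c a) k := fun _ _ _ _ hx => by
  have := hx.injective h
  have := hx.projective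
  exact .of_injective_of_projective k

/-- The uniserial module with top at `b + j` and of length `c b - j` is the `j`-th radical of the
projective module at `b`. If the latter is injective, then it is the injective envelope, and the
cokernel has its top at `b` and length `j`. -/
theorem ProjectiveInjectiveTerms.succ {b : ZMod n} {j l k : ℕ}
    (h : D.ProjectiveInjectiveTerms b j k) (hl : 0 < l) (hjl : j + l = c b)
    (hb : c (b - 1) ≤ c b) : D.ProjectiveInjectiveTerms (b + j) l (k + 1) := by
  intro M _ _ x hx
  have hP := D.isInterval_projective b
  have := D.projective_span_e b
  have := hP.injective hb
  have hj := hP.span_pow (i := j) (by lia)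
  rw [show c b - j = l by lia] at hj
  obtain ⟨f, hf⟩ := hx.exists_equiv hj
  refine .succ ((Submodule.subtype _) ∘ₗ f.toLinearMap) (Submodule.mkQ _)
    ((Submodule.subtype_injective _).comp f.injective) (Submodule.mkQ_surjective _) ?_ ?_
    (h (hP.quotient (i := j) (by lia)))
  · rw [LinearMap.range_comp_of_range_eq_top _ (LinearEquiv.range f), Submodule.range_subtype,
      Submodule.ker_mkQ]
  · rw [LinearMap.range_comp_of_range_eq_top _ (LinearEquiv.range f), Submodule.range_subtype]
    refine hP.isEssentialSubmodule fun h0 => ?_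
    exact hP.pow_smul_ne j (by lia) (Submodule.span_singleton_eq_bot.1 h0)

/-! ### The regular module -/

/-- The regular module is the direct sum of the projective modules at the vertices. -/
theorem exists_pi_span_e_equiv (D : CyclicPresentation K A n c) :
    Nonempty ((∀ a, Submodule.span A {D.e a}) ≃ₗ[A] A) := by
  have hmem : ∀ (a : ZMod n) (y : Submodule.span A {D.e a}), (y : A) * D.e a = y := by
    rintro a ⟨y, hy⟩
    obtain ⟨r, rfl⟩ := Submodule.mem_span_singleton.1 hy
    simp [mul_assoc, D.e_mul_self]
  have hmem' : ∀ (a b : ZMod n) (y : Submodule.span A {D.e a}), a ≠ b → (y : A) * D.e b = 0 := by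
    intro a b y hab
    rw [← hmem, mul_assoc, D.e_mul_of_ne a b hab, mul_zero]
  let f : (∀ a, Submodule.span A {D.e a}) →ₗ[A] A :=
    ∑ a, (Submodule.subtype _) ∘ₗ LinearMap.proj a
  have hf : ∀ y, f y = ∑ a, (y a : A) := fun y => by simp [f]
  refine ⟨LinearEquiv.ofBijective f ⟨?_, fun x => ?_⟩⟩
  · refine (injective_iff_map_eq_zero f).2 fun y hy => funext fun b => Subtype.ext ?_
    have := congrArg (· * D.e b) ((hf y).symm.trans hy)
    rwa [zero_mul, Finset.sum_mul, Finset.sum_eq_single b (fun a _ hab => hmem' a b _ hab)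
      (fun h => absurd (Finset.mem_univ b) h), hmem] at this
  · refine ⟨fun a => ⟨x * D.e a, Submodule.mem_span_singleton.2 ⟨x, rfl⟩⟩, ?_⟩
    rw [hf, ← Finset.mul_sum, D.sum_e, mul_one]

theorem hasProjectiveInjectiveTerms_regular {k : ℕ}
    (h : ∀ a, D.ProjectiveInjectiveTerms a (c a) k) : HasProjectiveInjectiveTerms A A k := by
  obtain ⟨f⟩ := D.exists_pi_span_e_equiv
  exact (HasProjectiveInjectiveTerms.pi fun a => h a (D.isInterval_projective a)).of_equiv f

/-- If `P_{a + 1}` is isomorphic to the radical of `P_a`, then it is not injective, because `P_a` is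
indecomposable. -/
theorem not_injective (D : CyclicPresentation K A n c) {a : ZMod n}
    (ha : 0 < c (a + 1)) (h : c (a + 1) + 1 = c a) :
    ¬ Module.Injective A A := by
  intro hA
  have hP := D.isInterval_projective a
  have hP' := D.isInterval_projective (a + 1)
  have : Module.Injective A (Submodule.span A {D.e (a + 1)}) := by
    refine .of_leftInverse (Submodule.subtype _)
      (LinearMap.toSpanSingleton A (Submodule.span A {D.e (a + 1)})
        ⟨D.e (a + 1), Submodule.mem_span_singleton_self _⟩) fun ⟨x, hx⟩ => ?_
    obtain ⟨r, rfl⟩ := Submodule.mem_span_singleton.1 hx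
    exact Subtype.ext (by simp [mul_assoc, D.e_mul_self])
  have hj := hP.span_pow (i := 1) (by lia)
  rw [← h, Nat.add_sub_cancel, Nat.cast_one] at hj
  obtain ⟨f, hf⟩ := hP'.exists_equiv hj
  obtain ⟨p, hp⟩ := this.out ((Submodule.subtype _) ∘ₗ f.toLinearMap)
    ((Submodule.subtype_injective _).comp f.injective) LinearMap.id
  have hinj : Function.Injective p := by
    refine LinearMap.ker_eq_bot.1 (hP.isEssentialSubmodule (N := Submodule.span A
      {D.t ^ 1 • (⟨D.e a, Submodule.mem_span_singleton_self _⟩ : Submodule.span A {D.e a})})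
      (fun h0 => ?_) _ (eq_bot_iff.2 ?_))
    · exact hP.pow_smul_ne 1 (by lia) (Submodule.span_singleton_eq_bot.1 h0)
    · rintro y ⟨hy, hy'⟩
      have := hp (f.symm ⟨y, hy⟩)
      rw [LinearMap.comp_apply, LinearEquiv.coe_coe, LinearEquiv.apply_symm_apply,
        Submodule.subtype_apply, LinearMap.mem_ker.1 hy', LinearMap.id_apply] at this
      simpa using this.symm
  have := Module.length_le_of_injective p hinj
  rw [hP.length_eq, hP'.length_eq, Nat.cast_le] at this
  lia

/-- If all simple modules have projective dimension at most `k` and the dominant dimension is at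
least `k`, then both dimensions equal `k`: the dominant dimension is at most the global dimension,
because `A` is not self-injective. -/
theorem dominantDimension_eq_and_globalDimension_eq {k : ℕ} (hk : 0 < k)
    (hpd : ∀ a, D.ProjectiveDimensionLE a 1 k) (hdd : ∀ a, D.ProjectiveInjectiveTerms a (c a) k)
    (hinj : ¬ Module.Injective A A) : dominantDimension A = k ∧ globalDimension A = k := by
  obtain ⟨k, rfl⟩ : ∃ j, k = j + 1 := ⟨k - 1, by lia⟩
  obtain ⟨I, ε, d, h1, h2⟩ := hasProjectiveInjectiveTerms_regular hdd
  have hpd' := hasProjectiveDimensionLE_of_simple hpd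
  have hfg : ∀ {I : ℕ → ModuleCat.{u} A} {ε : ModuleCat.of A A →ₗ[A] I 0}
      {d : ∀ i, I i →ₗ[A] I (i + 1)}, IsMinimalInjectiveResolution (ModuleCat.of A A) I ε d →
      ∀ i, Module.Finite A (I i) := by
    intro I ε d h i
    induction i with
    | zero =>
      have : Module.Finite A (ModuleCat.of A A) := inferInstanceAs (Module.Finite A A)
      exact D.finite_of_isEssentialSubmodule h.essential_zero
    | succ i ih => exact D.finite_of_isEssentialSubmodule (h.essential_succ i)
  constructor
  · refine le_antisymm (sSup_le ?_) (le_sSup ⟨I, ε, d, h1, fun i hi => h2 i (by exact_mod_cast hi)⟩)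
    rintro m ⟨I, ε, d, h1, h2⟩
    by_contra! hm
    have := hfg h1
    exact hinj (h1.injective_of_hasProjectiveDimensionLE (k + 1)
      (fun i hi => h2 i (lt_of_le_of_lt (by exact_mod_cast hi) hm)) (hpd' _))
  · refine le_antisymm (iSup₂_le fun M hM => ?_) ?_
    · exact (projectiveDimension_le_iff M (k + 1)).2 (hpd' M)
    · have := hfg h1
      refine le_trans ?_ (le_iSup₂ (f := fun (M : ModuleCat.{u} A) (_ : Module.Finite A M) =>
        projectiveDimension M) (ModuleCat.of A (LinearMap.range (d k))) inferInstance)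
      rw [projectiveDimension_ge_iff]
      intro hlt
      refine hinj (h1.injective_of_hasProjectiveDimensionLE k (fun i hi => h2 i (by lia)) hlt)

/-! ### Simple modules -/

/-- The top of a uniserial module is determined by the module; here for simple modules. -/
theorem IsInterval.eq_of_equiv {M : Type v} {N : Type w} [AddCommGroup M] [Module A M]
    [AddCommGroup N] [Module A N] {x : M} {y : N} {a b : ZMod n} (hx : D.IsInterval x a 1)
    (hy : D.IsInterval y b 1) (g : M ≃ₗ[A] N) : a = b := by
  by_contra hab
  obtain ⟨r, hr⟩ := hy.exists_smul_eq (g x)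
  obtain ⟨p, hp⟩ := D.exists_smul_eq_aeval (a := b) r
  have hty : D.t • y = 0 := by simpa using hy.pow_smul
  -- `r` acts on `y` as a scalar, because `t` kills `y`
  have hgx : g x = algebraMap K A (p.coeff 0) • y := by
    rw [← hr, hp y hy.e_smul, ← p.divX_mul_X_add, map_add, add_smul, map_mul, mul_smul,
      Polynomial.aeval_X, hty, smul_zero, zero_add, Polynomial.aeval_C]
    simp
  refine hx.ne_zero one_pos (g.injective ?_)
  rw [map_zero, ← hx.e_smul, map_smul, hgx, ← mul_smul, ← Algebra.commutes, mul_smul, ← hy.e_smul,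
    ← mul_smul (D.e a), D.e_mul_of_ne a b hab, zero_smul, smul_zero]

theorem algebraRank_eq (D : CyclicPresentation K A n c) (hc : ∀ a, 0 < c a) :
    algebraRank A = n := by
  have hS := fun a => (D.isInterval_projective a).quotient (i := 1) (hc a)
  set x : ∀ a, _ := fun a => (Submodule.Quotient.mk (⟨D.e a, Submodule.mem_span_singleton_self _⟩ :
    Submodule.span A {D.e a}) : _ ⧸ Submodule.span A {D.t ^ 1 •
      (⟨D.e a, Submodule.mem_span_singleton_self _⟩ : Submodule.span A {D.e a})})
  let φ := fun a => LinearMap.toSpanSingleton A _ (x a)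
  have hφ : ∀ a, Function.Surjective (φ a) := fun a m => (hS a).exists_smul_eq m
  have hmax : ∀ a, Ideal.IsMaximal (LinearMap.ker (φ a)) := fun a => by
    have := (hS a).length_one_isSimpleModule
    rw [Ideal.isMaximal_def, ← isSimpleModule_iff_isCoatom]
    exact IsSimpleModule.congr ((φ a).quotKerEquivOfSurjective (hφ a))
  let ψ : ZMod n → Quotient (simpleQuotientSetoid A) := fun a =>
    Quotient.mk _ ⟨LinearMap.ker (φ a), hmax a⟩
  have hψ : Function.Bijective ψ := by
    constructor
    · intro a b hab
      obtain ⟨f⟩ := Quotient.exact hab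
      let g := ((φ a).quotKerEquivOfSurjective (hφ a)).symm.trans
        (f.trans ((φ b).quotKerEquivOfSurjective (hφ b)))
      exact (hS a).eq_of_equiv (hS b) g
    · rintro ⟨m, hm⟩
      have : IsSimpleModule A (A ⧸ m) := isSimpleModule_iff_isCoatom.2 hm.out
      obtain ⟨a, y, hy⟩ := D.exists_isInterval_of_isSimpleModule (A ⧸ m)
      obtain ⟨f, -⟩ := (hS a).exists_equiv hy
      exact ⟨a, Quotient.sound ⟨((φ a).quotKerEquivOfSurjective (hφ a)).trans f⟩⟩
  rw [algebraRank, ← Nat.card_congr (Equiv.ofBijective ψ hψ), Nat.card_zmod]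

end CyclicPresentation

/-! ### The bound quiver algebra with a given Kupisch series -/

namespace CyclicQuiver

open PathAlgebra

variable (K : Type u) [Field K] {n : ℕ}

/-- The span of all paths that start at a vertex `a` and have length at least `c a`. -/
noncomputable def longPaths (c : CyclicQuiver n → ℕ) :
    Submodule K (PathAlgebra K (CyclicQuiver n)) :=
  Submodule.span K (pathBasis K (CyclicQuiver n) '' {s | c s.1 ≤ s.2.2.length})

variable {c : CyclicQuiver n → ℕ}

variable {K} in
theorem ofPath_mem_longPaths_iff {a b : CyclicQuiver n} (p : Quiver.Path a b) :
    ofPath K p ∈ longPaths K c ↔ c a ≤ p.length := by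
  rw [longPaths, Module.Basis.mem_span_image, ofPath, Module.Basis.repr_self,
    Finsupp.support_single _ one_ne_zero]
  simp

theorem le_length_add (hc : ∀ a, c a ≤ c (a + 1) + 1) {a b : CyclicQuiver n}
    (p : Quiver.Path a b) : c a ≤ p.length + c b := by
  induction p with
  | nil => simp
  | cons p h ih =>
    obtain ⟨rfl⟩ := h
    rw [Quiver.Path.length_cons]
    exact ih.trans (by have := hc ‹_›; lia)

theorem exists_path_length_eq (a : CyclicQuiver n) (i : ℕ) :
    ∃ (b : CyclicQuiver n) (p : Quiver.Path a b), p.length = i := by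
  induction i with
  | zero => exact ⟨a, .nil, rfl⟩
  | succ i ih =>
    obtain ⟨b, p, rfl⟩ := ih
    exact ⟨b + 1, p.cons ⟨rfl⟩, rfl⟩

variable [NeZero n]

theorem mul_mem_longPaths_left (x : PathAlgebra K (CyclicQuiver n))
    {y : PathAlgebra K (CyclicQuiver n)} (hy : y ∈ longPaths K c) : x * y ∈ longPaths K c := by
  induction x using PathAlgebra.induction_on with
  | h0 => rw [zero_mul]; exact zero_mem _
  | hadd x x' hx hx' => rw [add_mul]; exact add_mem hx hx'
  | hsmul r a b p =>
    rw [smul_mul_assoc]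
    refine Submodule.smul_mem _ _ ?_
    induction hy using Submodule.span_induction with
    | mem y h =>
      obtain ⟨⟨d, b', q⟩, hq, rfl⟩ := h
      change ofPath K p * ofPath K q ∈ _
      by_cases hb : b' = a
      · subst hb
        rw [ofPath_mul_ofPath, ofPath_mem_longPaths_iff, Quiver.Path.length_comp]
        exact le_trans hq (Nat.le_add_right _ _)
      · rw [ofPath_mul_ofPath_of_ne K _ _ hb]; exact zero_mem _
    | zero => rw [mul_zero]; exact zero_mem _
    | add y y' _ _ h h' => rw [mul_add]; exact add_mem h h'
    | smul k y _ h => rw [mul_smul_comm]; exact Submodule.smul_mem _ _ h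

theorem mul_mem_longPaths_right (hc : ∀ a, c a ≤ c (a + 1) + 1)
    {x : PathAlgebra K (CyclicQuiver n)} (y : PathAlgebra K (CyclicQuiver n))
    (hx : x ∈ longPaths K c) : x * y ∈ longPaths K c := by
  induction y using PathAlgebra.induction_on with
  | h0 => rw [mul_zero]; exact zero_mem _
  | hadd y y' hy hy' => rw [mul_add]; exact add_mem hy hy'
  | hsmul r a b p =>
    rw [mul_smul_comm]
    refine Submodule.smul_mem _ _ ?_
    induction hx using Submodule.span_induction with
    | mem x h =>
      obtain ⟨⟨d, b', q⟩, hq, rfl⟩ := h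
      change ofPath K q * ofPath K p ∈ _
      by_cases hb : b = d
      · subst hb
        rw [ofPath_mul_ofPath, ofPath_mem_longPaths_iff, Quiver.Path.length_comp]
        exact (le_length_add hc p).trans (Nat.add_le_add_left hq _)
      · rw [ofPath_mul_ofPath_of_ne K _ _ hb]; exact zero_mem _
    | zero => rw [zero_mul]; exact zero_mem _
    | add x x' _ _ h h' => rw [add_mul]; exact add_mem h h'
    | smul k x _ h => rw [smul_mul_assoc]; exact Submodule.smul_mem _ _ h

/-- The ideal spanned by all paths that start at a vertex `a` and have length at least `c a`. It is
two-sided because `c a ≤ c (a + 1) + 1`. -/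
noncomputable def kupischIdeal (hc : ∀ a, c a ≤ c (a + 1) + 1) :
    TwoSidedIdeal (PathAlgebra K (CyclicQuiver n)) :=
  .mk' (longPaths K c) (zero_mem _) add_mem neg_mem (mul_mem_longPaths_left K _)
    (mul_mem_longPaths_right K hc _)

theorem mem_kupischIdeal_iff {hc : ∀ a, c a ≤ c (a + 1) + 1}
    {x : PathAlgebra K (CyclicQuiver n)} : x ∈ kupischIdeal K hc ↔ x ∈ longPaths K c :=
  TwoSidedIdeal.mem_mk' ..

theorem isAdmissible_kupischIdeal (hc : ∀ a, c a ≤ c (a + 1) + 1) (hc2 : ∀ a, 2 ≤ c a) :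
    IsAdmissible (kupischIdeal K hc) := by
  refine ⟨fun x hx => ?_, 2 + ∑ a, c a, Nat.le_add_right _ _, fun x hx => ?_⟩
  · rw [mem_kupischIdeal_iff] at hx
    refine Submodule.span_mono ?_ hx
    rintro _ ⟨⟨a, b, p⟩, hp, rfl⟩
    exact ⟨a, b, p, (hc2 a).trans hp, rfl⟩
  · rw [mem_kupischIdeal_iff]
    refine Submodule.span_le.2 ?_ hx
    rintro _ ⟨a, b, p, hp, rfl⟩
    refine (ofPath_mem_longPaths_iff p).2 (le_trans ?_ hp)
    exact (Finset.single_le_sum (f := c) (fun _ _ => Nat.zero_le _) (Finset.mem_univ a)).trans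
      (Nat.le_add_left _ _)

variable (n) in
/-- The sum of all arrows. -/
noncomputable def arrowSum : PathAlgebra K (CyclicQuiver n) :=
  ∑ a : CyclicQuiver n, ofPath K (Quiver.Hom.toPath (⟨rfl⟩ : a ⟶ a + 1))

theorem arrowSum_mul_ofPath {a b : CyclicQuiver n} (p : Quiver.Path a b) :
    arrowSum K n * ofPath K p = ofPath K (p.cons (⟨rfl⟩ : b ⟶ b + 1)) := by
  rw [arrowSum, Finset.sum_mul, Finset.sum_eq_single b]
  · rw [ofPath_mul_ofPath]; rfl
  · intro d _ hd
    exact ofPath_mul_ofPath_of_ne K _ _ hd.symm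
  · exact fun h => absurd (Finset.mem_univ b) h

theorem nil_mul_arrowSum (a : CyclicQuiver n) :
    ofPath K (Quiver.Path.nil : Quiver.Path (a + 1) (a + 1)) * arrowSum K n =
      ofPath K (Quiver.Hom.toPath (⟨rfl⟩ : a ⟶ a + 1)) := by
  rw [arrowSum, Finset.mul_sum, Finset.sum_eq_single a]
  · rw [ofPath_mul_ofPath, Quiver.Path.comp_nil]
  · intro d _ hd
    exact ofPath_mul_ofPath_of_ne K _ _ fun h => hd (add_right_cancel h)
  · exact fun h => absurd (Finset.mem_univ a) h

theorem arrowSum_pow_mul_nil {a b : CyclicQuiver n} (p : Quiver.Path a b) :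
    arrowSum K n ^ p.length * ofPath K (Quiver.Path.nil : Quiver.Path a a) = ofPath K p := by
  induction p with
  | nil => simp
  | cons p h ih =>
    obtain ⟨rfl⟩ := h
    rw [Quiver.Path.length_cons, pow_succ', mul_assoc, ih, arrowSum_mul_ofPath]

theorem vertexIdempotent_eq (I : TwoSidedIdeal (PathAlgebra K (CyclicQuiver n)))
    (a : CyclicQuiver n) : vertexIdempotent I a =
      I.ringCon.mk' (ofPath K (Quiver.Path.nil : Quiver.Path a a)) := rfl

variable {K} in
theorem vertexIdempotent_mul_self (I : TwoSidedIdeal (PathAlgebra K (CyclicQuiver n)))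
    (a : CyclicQuiver n) : vertexIdempotent I a * vertexIdempotent I a = vertexIdempotent I a := by
  rw [vertexIdempotent_eq, ← map_mul, ofPath_mul_ofPath, Quiver.Path.nil_comp]

variable {K} in
theorem vertexIdempotent_mul_of_ne (I : TwoSidedIdeal (PathAlgebra K (CyclicQuiver n)))
    (a b : CyclicQuiver n) (hab : a ≠ b) : vertexIdempotent I a * vertexIdempotent I b = 0 := by
  rw [vertexIdempotent_eq, vertexIdempotent_eq, ← map_mul,
    ofPath_mul_ofPath_of_ne K _ _ (Ne.symm hab), map_zero]

variable {K} in
theorem arrowSum_pow_mul_vertexIdempotent (I : TwoSidedIdeal (PathAlgebra K (CyclicQuiver n)))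
    {a b : CyclicQuiver n} (p : Quiver.Path a b) :
    I.ringCon.mk' (arrowSum K n) ^ p.length * vertexIdempotent I a =
      I.ringCon.mk' (ofPath K p) := by
  rw [vertexIdempotent_eq, ← map_pow, ← map_mul, arrowSum_pow_mul_nil]

theorem arrowSum_pow_mul_vertexIdempotent_eq_zero_iff (hc : ∀ a, c a ≤ c (a + 1) + 1)
    (a : CyclicQuiver n) (i : ℕ) :
    (kupischIdeal K hc).ringCon.mk' (arrowSum K n) ^ i * vertexIdempotent (kupischIdeal K hc) a = 0
      ↔ c a ≤ i := by
  obtain ⟨b, p, rfl⟩ := exists_path_length_eq a i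
  rw [arrowSum_pow_mul_vertexIdempotent, ← ofPath_mem_longPaths_iff (K := K) p,
    ← mem_kupischIdeal_iff K (hc := hc), TwoSidedIdeal.mem_iff]
  exact RingCon.eq _

variable {K} in
theorem mem_span_arrowSum_pow_mul (I : TwoSidedIdeal (PathAlgebra K (CyclicQuiver n)))
    (x : BoundQuiverAlgebra I) : x ∈ Submodule.span K
      {y | ∃ (i : ℕ) (a : CyclicQuiver n),
        y = I.ringCon.mk' (arrowSum K n) ^ i * vertexIdempotent I a} := by
  obtain ⟨x, rfl⟩ := RingCon.mk'_surjective I.ringCon x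
  induction x using PathAlgebra.induction_on with
  | h0 => rw [map_zero]; exact zero_mem _
  | hadd x x' hx hx' => rw [map_add]; exact add_mem hx hx'
  | hsmul r a b p =>
    have hp : I.ringCon.mk' (ofPath K p) ∈ Submodule.span K
        {y | ∃ (i : ℕ) (a : CyclicQuiver n),
          y = I.ringCon.mk' (arrowSum K n) ^ i * vertexIdempotent I a} :=
      Submodule.subset_span ⟨p.length, a, (arrowSum_pow_mul_vertexIdempotent I p).symm⟩
    exact Submodule.smul_mem _ r hp

/-- The bound quiver algebra of `kupischIdeal` is the Nakayama algebra with Kupisch series `c`. -/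
noncomputable def presentation (hc : ∀ a, c a ≤ c (a + 1) + 1) :
    CyclicPresentation K (BoundQuiverAlgebra (kupischIdeal K hc)) n c where
  e := vertexIdempotent (kupischIdeal K hc)
  t := (kupischIdeal K hc).ringCon.mk' (arrowSum K n)
  e_mul_self := vertexIdempotent_mul_self _
  e_mul_of_ne := vertexIdempotent_mul_of_ne _
  sum_e := (map_sum (kupischIdeal K hc).ringCon.mk'
    (fun a : CyclicQuiver n => ofPath K (Quiver.Path.nil : Quiver.Path a a)) _).symm.trans
      (map_one _)
  t_mul_e _ := (map_mul _ _ _).symm.trans ((congrArg _ ((arrowSum_mul_ofPath K _).trans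
    (nil_mul_arrowSum K _).symm)).trans (map_mul _ _ _))
  pow_mul_e_eq_zero _ := (arrowSum_pow_mul_vertexIdempotent_eq_zero_iff K hc _ _).2 le_rfl
  pow_mul_e_ne_zero _ _ hi h :=
    absurd hi ((arrowSum_pow_mul_vertexIdempotent_eq_zero_iff K hc _ _).1 h).not_gt
  mem_span := mem_span_arrowSum_pow_mul _

/-- The homological data of the uniserial modules of `presentation` determine all properties of the
bound quiver algebra of `kupischIdeal`. -/
theorem exists_isHigherAuslander {c : CyclicQuiver n → ℕ} (hc : ∀ a, c a ≤ c (a + 1) + 1)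
    (hc2 : ∀ a, 2 ≤ c a) {l : List ℕ} (hl : l.length = n)
    (hlc : ∀ (i : ℕ) (hi : i < l.length), c (i : CyclicQuiver n) = l[i]) {k : ℕ} (hk : 0 < k)
    (hpd : ∀ a, (presentation K hc).ProjectiveDimensionLE a 1 k)
    (hdd : ∀ a, (presentation K hc).ProjectiveInjectiveTerms a (c a) k)
    (a : CyclicQuiver n) (ha : c (a + 1) + 1 = c a) :
    ∃ I : TwoSidedIdeal (PathAlgebra K (CyclicQuiver n)),
      IsCyclicNakayama I ∧ HasKupischSeries I l ∧ algebraRank (BoundQuiverAlgebra I) = n ∧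
      IsHigherAuslander K (BoundQuiverAlgebra I) ∧ globalDimension (BoundQuiverAlgebra I) = k := by
  let D := presentation K hc
  have hinj : ¬ Module.Injective (BoundQuiverAlgebra (kupischIdeal K hc))
      (BoundQuiverAlgebra (kupischIdeal K hc)) :=
    D.not_injective (a := a) (lt_of_lt_of_le two_pos (hc2 _)) ha
  obtain ⟨h1, h2⟩ := CyclicPresentation.dominantDimension_eq_and_globalDimension_eq hk hpd hdd hinj
  refine ⟨kupischIdeal K hc, ⟨isAdmissible_kupischIdeal K hc hc2, D.finite, fun M _ _ _ hM =>
    CyclicPresentation.isUniserial_of_isIndecomposableModule D hM⟩, ⟨hl, fun i hi => ?_⟩,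
    D.algebraRank_eq fun b => lt_of_lt_of_le two_pos (hc2 b), ⟨D.finite, ?_⟩, h2⟩
  · exact (D.isInterval_projective (i : CyclicQuiver n)).length_eq.trans
      (congrArg Nat.cast (hlc i hi))
  · rw [h1, h2]; rfl

end CyclicQuiver

/-! ### The Kupisch series `(n, n - 1, (n - 2)^(n - 2))` -/

namespace CyclicPresentation

variable {K : Type u} {A : Type u} [Field K] [Ring A] [Algebra K A]

section

variable {r : ℕ} {c : ZMod (2 * r + 3) → ℕ} (D : CyclicPresentation K A (2 * r + 3) c)

theorem c_neg_one (hc : ∀ i : ℕ, 2 ≤ i → i < 2 * r + 3 → c i = 2 * r + 1) :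
    c (0 - 1) = 2 * r + 1 := by
  have h : (0 - 1 : ZMod (2 * r + 3)) = (2 * r + 2 : ℕ) := by
    rw [sub_eq_iff_eq_add, ← Nat.cast_succ, ZMod.natCast_self]
  rw [h, hc _ (by lia) (by lia)]

/-- Two cosyzygies lead from top `0` and length `j` to top `0` and length `j + 2`. -/
theorem projectiveInjectiveTerms_top_zero (hc0 : c 0 = 2 * r + 3)
    (hc : ∀ i : ℕ, 2 ≤ i → i < 2 * r + 3 → c i = 2 * r + 1) (s j : ℕ) (hj : 0 < j)
    (h1 : 2 * r + 1 ≤ j + 2 * s) (h2 : j + 2 * s ≤ 2 * r + 2) :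
    D.ProjectiveInjectiveTerms 0 j (2 * s) := by
  induction s generalizing j with
  | zero => exact projectiveInjectiveTerms_zero (by rw [c_neg_one hc]; lia)
  | succ s ih =>
    have h := (ih (j + 2) (by lia) (by lia) (by lia)).succ (l := 2 * r + 1 - j) (by lia)
      (by rw [hc0]; lia) (by rw [c_neg_one hc, hc0]; lia)
    rw [zero_add] at h
    have h' := h.succ (l := j) hj (by rw [hc _ (by lia) (by lia)]; lia) (by
      have : ((j + 2 : ℕ) : ZMod (2 * r + 3)) - 1 = ((j + 1 : ℕ) : ZMod (2 * r + 3)) := by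
        push_cast; ring
      rw [this, hc _ (by lia) (by lia), hc _ (by lia) (by lia)])
    have h0 : ((j + 2 : ℕ) : ZMod (2 * r + 3)) + ((2 * r + 1 - j : ℕ) : ZMod (2 * r + 3)) = 0 := by
      rw [← Nat.cast_add, show j + 2 + (2 * r + 1 - j) = 2 * r + 3 by lia, ZMod.natCast_self]
    rwa [h0] at h'

theorem projectiveInjectiveTerms_projective (hc0 : c 0 = 2 * r + 3) (hc1 : c 1 = 2 * r + 2)
    (hc : ∀ i : ℕ, 2 ≤ i → i < 2 * r + 3 → c i = 2 * r + 1) (a : ZMod (2 * r + 3)) :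
    D.ProjectiveInjectiveTerms a (c a) (2 * r + 1) := by
  obtain ⟨i, hi, rfl⟩ : ∃ i : ℕ, i < 2 * r + 3 ∧ (i : ZMod (2 * r + 3)) = a :=
    ⟨a.val, a.val_lt, ZMod.natCast_zmod_val a⟩
  have hle : c (0 - 1) ≤ c 0 := by rw [c_neg_one hc, hc0]; lia
  match i, hi with
  | 0, _ => exact projectiveInjectiveTerms_of_le (by simpa using hle) _
  | 1, _ =>
    have h := (projectiveInjectiveTerms_top_zero D hc0 hc r 1 (by lia) (by lia) (by lia)).succ
      (l := 2 * r + 2) (by lia) (by rw [hc0]; lia) hle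
    rwa [zero_add, ← hc1, ← Nat.cast_one] at h
  | 2, hi =>
    have h := (projectiveInjectiveTerms_top_zero D hc0 hc r 2 (by lia) (by lia) (by lia)).succ
      (l := 2 * r + 1) (by lia) (by rw [hc0]; lia) hle
    rw [hc 2 le_rfl hi]
    rwa [zero_add] at h
  | i + 3, hi =>
    refine projectiveInjectiveTerms_of_le ?_ _
    have : ((i + 3 : ℕ) : ZMod (2 * r + 3)) - 1 = ((i + 2 : ℕ) : ZMod (2 * r + 3)) := by
      push_cast; ring
    rw [this, hc _ (by lia) (by lia), hc _ (by lia) (by lia)]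

/-- Two syzygies lead from top `0` and length `2 * i + 2` to top `0` and length `2 * i`. -/
theorem projectiveDimensionLE_top_zero (hc0 : c 0 = 2 * r + 3)
    (hc : ∀ i : ℕ, 2 ≤ i → i < 2 * r + 3 → c i = 2 * r + 1) (i : ℕ) (hi : i < r) :
    D.ProjectiveDimensionLE 0 (2 * i + 2) (2 * i + 1) := by
  induction i with
  | zero =>
    refine .succ (projectiveDimensionLE_zero ?_)
    rw [zero_add, hc0, hc _ (by lia) (by lia)]
    lia
  | succ i ih =>
    have h := ih (by lia)
    refine .succ (d := 2 * i + 2) ?_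
    rw [zero_add, hc0]
    refine .succ ?_
    rw [hc _ (by lia) (by lia), ← Nat.cast_add,
      show 2 * (i + 1) + 2 + (2 * r + 3 - (2 * (i + 1) + 2)) = 2 * r + 3 by lia, ZMod.natCast_self,
      show 2 * r + 1 - (2 * r + 3 - (2 * (i + 1) + 2)) = 2 * i + 2 by lia]
    exact h

/-- Two syzygies lead from the simple module at `a` to the simple module at `a - 2`. -/
theorem projectiveDimensionLE_simple_of_le (hc0 : c 0 = 2 * r + 3) (hc1 : c 1 = 2 * r + 2)
    (hc : ∀ i : ℕ, 2 ≤ i → i < 2 * r + 3 → c i = 2 * r + 1) (s i : ℕ)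
    (his : i ≤ 2 * s + 1) (hi : i ≤ 2 * r + 1) : D.ProjectiveDimensionLE i 1 (2 * s + 1) := by
  induction s generalizing i with
  | zero =>
    refine .succ (projectiveDimensionLE_zero ?_)
    interval_cases i
    · simp [hc0, hc1]
    · rw [← Nat.cast_add, hc (1 + 1) (by lia) (by lia), Nat.cast_one, hc1]
      lia
  | succ s ih =>
    rcases Nat.lt_or_ge i 2 with h | h
    · exact (ih i (by lia) hi).mono (by lia)
    · refine .succ (d := 2 * s + 2) (.succ ?_)
      rw [← Nat.cast_add, hc _ h (by lia), hc _ (by lia) (by lia), ← Nat.cast_add,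
        show i + 1 + (2 * r + 1 - 1) = 2 * r + 3 + (i - 2) by lia, Nat.cast_add, ZMod.natCast_self,
        zero_add, show 2 * r + 1 - (2 * r + 1 - 1) = 1 by lia]
      exact ih _ (by lia) (by lia)

/-- The vertex `n - 1` is special: the syzygy of its simple module has top `0` and length
`n - 3`. -/
theorem projectiveDimensionLE_simple (hr : 0 < r) (hc0 : c 0 = 2 * r + 3) (hc1 : c 1 = 2 * r + 2)
    (hc : ∀ i : ℕ, 2 ≤ i → i < 2 * r + 3 → c i = 2 * r + 1) (a : ZMod (2 * r + 3)) :
    D.ProjectiveDimensionLE a 1 (2 * r + 1) := by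
  obtain ⟨i, hi, rfl⟩ : ∃ i : ℕ, i < 2 * r + 3 ∧ (i : ZMod (2 * r + 3)) = a :=
    ⟨a.val, a.val_lt, ZMod.natCast_zmod_val a⟩
  rcases Nat.lt_or_ge i (2 * r + 2) with h | h
  · exact projectiveDimensionLE_simple_of_le D hc0 hc1 hc r i (by lia) (by lia)
  · obtain rfl : i = 2 * r + 2 := by lia
    refine .succ (d := 2 * r) ?_
    rw [hc _ (by lia) hi, ← Nat.cast_add, ZMod.natCast_self]
    have := projectiveDimensionLE_top_zero D hc0 hc (r - 1) (by lia)
    rw [show 2 * (r - 1) + 2 = 2 * r + 1 - 1 by lia] at this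
    exact this.mono (by lia)

end

/-! ### The Kupisch series `(m, (m - 1)^(m - 1), m, (m - 1)^(m - 1))` -/

section

variable {n : ℕ} [NeZero n] {r : ℕ} {c : ZMod n → ℕ} (D : CyclicPresentation K A n c)
  {H : Set (ZMod n)}

/-- Two cosyzygies lead from length `j` to length `j + 1`, and from one half of the cycle to the
other. Here `m = r + 2`, and `H` is the set of the two vertices, at distance `m` from each other,
whose projective modules have length `m`. -/
theorem projectiveInjectiveTerms_of_mem (hn : ((r + 2 : ℕ) + (r + 2 : ℕ) : ZMod n) = 0)
    (hH : ∀ h ∈ H, h + (r + 2 : ℕ) ∈ H) (hc0 : ∀ h ∈ H, c h = r + 2)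
    (hc : ∀ h ∈ H, ∀ i : ℕ, 0 < i → i < r + 2 → c (h + i) = r + 1) (s j : ℕ) (hj : 0 < j)
    (hjs : j + s = r + 1) {h : ZMod n} (hh : h ∈ H) :
    D.ProjectiveInjectiveTerms h j (2 * s) := by
  have hpred : ∀ h ∈ H, c (h - 1) = r + 1 := fun h hh => by
    rw [← hc _ (hH h hh) (r + 1) (by lia) (by lia)]
    congr 1
    rw [sub_eq_iff_eq_add, add_assoc, add_assoc, ← Nat.cast_succ, hn, add_zero]
  induction s generalizing j h with
  | zero => exact projectiveInjectiveTerms_zero (by rw [hpred h hh]; lia)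
  | succ s ih =>
    have h1 := (ih (j + 1) (by lia) (by lia) (hH h hh)).succ (l := r + 1 - j) (by lia)
      (by rw [hc0 _ (hH h hh)]; lia) (by rw [hpred _ (hH h hh), hc0 _ (hH h hh)]; lia)
    have h2 := h1.succ (l := j) hj (by rw [hc _ (hH h hh) _ (by lia) (by lia)]; lia) (by
      rw [hc _ (hH h hh) _ (by lia) (by lia), Nat.cast_succ j, ← add_assoc, add_sub_cancel_right,
        hc _ (hH h hh) _ hj (by lia)])
    rwa [add_assoc, ← Nat.cast_add, show j + 1 + (r + 1 - j) = r + 2 by lia, add_assoc, hn,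
      add_zero] at h2

theorem projectiveInjectiveTerms_projective_of_mem (hn : ((r + 2 : ℕ) + (r + 2 : ℕ) : ZMod n) = 0)
    (hH : ∀ h ∈ H, h + (r + 2 : ℕ) ∈ H) (hc0 : ∀ h ∈ H, c h = r + 2)
    (hc : ∀ h ∈ H, ∀ i : ℕ, 0 < i → i < r + 2 → c (h + i) = r + 1)
    (hcov : ∀ a, ∃ h ∈ H, ∃ i < r + 2, a = h + (i : ℕ)) (a : ZMod n) :
    D.ProjectiveInjectiveTerms a (c a) (2 * r + 1) := by
  have hpred : ∀ h ∈ H, c (h - 1) ≤ c h := fun h hh => by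
    have : h - 1 = h + (r + 2 : ℕ) + (r + 1 : ℕ) := by
      rw [sub_eq_iff_eq_add, add_assoc, add_assoc, ← Nat.cast_succ, hn, add_zero]
    rw [this, hc _ (hH h hh) (r + 1) (by lia) (by lia), hc0 h hh]; lia
  obtain ⟨h, hh, i, hi, rfl⟩ := hcov a
  match i, hi with
  | 0, _ => exact projectiveInjectiveTerms_of_le (by simpa using hpred h hh) _
  | 1, hi =>
    rw [hc h hh 1 one_pos hi]
    exact (projectiveInjectiveTerms_of_mem D hn hH hc0 hc r 1 one_pos (by lia) hh).succ (by lia)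
      (by rw [hc0 h hh]; lia) (hpred h hh)
  | i + 2, hi =>
    refine projectiveInjectiveTerms_of_le ?_ _
    rw [hc h hh _ (by lia) hi, Nat.cast_succ, ← add_assoc, add_sub_cancel_right,
      hc h hh _ (by lia) (by lia)]

/-- Two syzygies lead from length `j + 1` to length `j`, and from one half of the cycle to the
other. -/
theorem projectiveDimensionLE_of_mem
    (hH : ∀ h ∈ H, h + (r + 2 : ℕ) ∈ H) (hc0 : ∀ h ∈ H, c h = r + 2)
    (hc : ∀ h ∈ H, ∀ i : ℕ, 0 < i → i < r + 2 → c (h + i) = r + 1) (j : ℕ) (hj : j ≤ r)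
    {h : ZMod n} (hh : h ∈ H) : D.ProjectiveDimensionLE h (j + 1) (2 * j + 1) := by
  induction j generalizing h with
  | zero =>
    refine .succ (projectiveDimensionLE_zero ?_)
    rw [hc0 h hh, hc h hh _ (by lia) (by lia)]
    lia
  | succ j ih =>
    refine .succ (d := 2 * j + 2) (.succ ?_)
    rw [hc0 h hh, hc h hh _ (by lia) (by lia), add_assoc, ← Nat.cast_add,
      show j + 1 + 1 + (r + 2 - (j + 1 + 1)) = r + 2 by lia,
      show r + 1 - (r + 2 - (j + 1 + 1)) = j + 1 by lia]
    exact ih (by lia) (hH h hh)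

theorem projectiveDimensionLE_simple_of_mem (hr : 0 < r)
    (hH : ∀ h ∈ H, h + (r + 2 : ℕ) ∈ H) (hc0 : ∀ h ∈ H, c h = r + 2)
    (hc : ∀ h ∈ H, ∀ i : ℕ, 0 < i → i < r + 2 → c (h + i) = r + 1)
    (hcov : ∀ a, ∃ h ∈ H, ∃ i < r + 2, a = h + (i : ℕ)) (a : ZMod n) :
    D.ProjectiveDimensionLE a 1 (2 * r + 1) := by
  have key : ∀ i ≤ r, ∀ h ∈ H, D.ProjectiveDimensionLE (h + (i : ℕ)) 1 (2 * i + 1) := by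
    intro i
    induction i with
    | zero =>
      intro _ h hh
      rw [Nat.cast_zero, add_zero]
      exact projectiveDimensionLE_of_mem D hH hc0 hc 0 (by lia) hh
    | succ i ih =>
      intro hi h hh
      refine .succ (d := 2 * i + 2) (.succ ?_)
      have := ih (by lia) _ (hH h hh)
      rw [hc h hh _ (by lia) (by lia), add_assoc h, ← Nat.cast_add, hc h hh _ (by lia) (by lia),
        add_assoc, ← Nat.cast_add, show i + 1 + 1 + (r + 1 - 1) = r + 2 + i by lia, Nat.cast_add,
        ← add_assoc, show r + 1 - (r + 1 - 1) = 1 by lia]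
      exact this
  obtain ⟨h, hh, i, hi, rfl⟩ := hcov a
  rcases Nat.lt_or_ge r i with hi' | hi'
  · obtain rfl : i = r + 1 := by lia
    refine .succ (d := 2 * r) ?_
    rw [hc h hh _ (by lia) hi, add_assoc, ← Nat.cast_add]
    have := projectiveDimensionLE_of_mem D hH hc0 hc (r - 1) (by lia) (hH h hh)
    rw [show r - 1 + 1 = r + 1 - 1 by lia] at this
    exact this.mono (by lia)
  · exact (key i hi' h hh).mono (by lia)

end

end CyclicPresentation

/-! ### The two families -/

namespace CyclicQuiver

variable (K : Type u) [Field K]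

theorem natCast_val {n : ℕ} {i : ℕ} (hi : i < n) :
    ZMod.val ((i : CyclicQuiver n) : ZMod n) = i :=
  ZMod.val_natCast_of_lt hi

theorem exists_natCast {n : ℕ} [NeZero n] (a : CyclicQuiver n) :
    ∃ i < n, (i : CyclicQuiver n) = a :=
  ⟨ZMod.val (a : ZMod n), ZMod.val_lt _, ZMod.natCast_zmod_val (n := n) a⟩

theorem natCast_add_one (n i : ℕ) :
    (i : CyclicQuiver n) + 1 = ((i + 1 : ℕ) : CyclicQuiver n) := (Nat.cast_succ i).symm

/-- The first family, with `k = 2 * r + 1` and `n = 2 * r + 3`. -/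
theorem exists_isHigherAuslander_rank_add_two {r : ℕ} (hr : 0 < r) :
    ∃ I : TwoSidedIdeal (PathAlgebra K (CyclicQuiver (2 * r + 3))),
      IsCyclicNakayama I ∧
      HasKupischSeries I ([2 * r + 3, 2 * r + 2] ++ List.replicate (2 * r + 1) (2 * r + 1)) ∧
      algebraRank (BoundQuiverAlgebra I) = 2 * r + 3 ∧
      IsHigherAuslander K (BoundQuiverAlgebra I) ∧
      globalDimension (BoundQuiverAlgebra I) = (2 * r + 1 : ℕ) := by
  let c : CyclicQuiver (2 * r + 3) → ℕ := fun a =>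
    if ZMod.val (a : ZMod (2 * r + 3)) = 0 then 2 * r + 3
    else if ZMod.val (a : ZMod (2 * r + 3)) = 1 then 2 * r + 2 else 2 * r + 1
  have hc0 : c ((0 : ℕ) : CyclicQuiver (2 * r + 3)) = 2 * r + 3 := by
    simp only [c]; rw [natCast_val (by lia)]; simp
  have hc1 : c ((1 : ℕ) : CyclicQuiver (2 * r + 3)) = 2 * r + 2 := by
    simp only [c]; rw [natCast_val (by lia)]; simp
  have hci : ∀ i : ℕ, 2 ≤ i → i < 2 * r + 3 → c (i : CyclicQuiver (2 * r + 3)) = 2 * r + 1 := by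
    intro i hi hi'
    simp only [c]; rw [natCast_val (by lia), if_neg (by lia), if_neg (by lia)]
  have hcle : ∀ a, 2 * r + 1 ≤ c a := fun a => by simp only [c]; split_ifs <;> lia
  have hc : ∀ a, c a ≤ c (a + 1) + 1 := by
    intro a
    obtain ⟨i, hi, rfl⟩ := exists_natCast a
    rcases Nat.eq_zero_or_pos i with rfl | h0
    · rw [natCast_add_one, hc0, hc1]
    · rcases Nat.eq_or_lt_of_le h0 with rfl | h1
      · exact hc1.le.trans (Nat.succ_le_succ (hcle _))
      · exact (hci i h1 hi).le.trans ((hcle _).trans (Nat.le_succ _))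
  have h0 : c (0 : CyclicQuiver (2 * r + 3)) = 2 * r + 3 :=
    (congrArg c Nat.cast_zero.symm).trans hc0
  have h1 : c (1 : CyclicQuiver (2 * r + 3)) = 2 * r + 2 :=
    (congrArg c Nat.cast_one.symm).trans hc1
  refine exists_isHigherAuslander K hc (fun a => le_trans (by lia) (hcle a)) (by simp)
    (fun i hi => ?_) (by lia)
    (CyclicPresentation.projectiveDimensionLE_simple _ hr h0 h1 hci)
    (CyclicPresentation.projectiveInjectiveTerms_projective _ h0 h1 hci)
    ((0 : ℕ) : CyclicQuiver (2 * r + 3)) ?_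
  · match i with
    | 0 => exact hc0
    | 1 => exact hc1
    | i + 2 =>
      have hi : i + 2 < 2 * r + 3 := by simpa using hi
      rw [hci _ (by lia) hi]
      simp
  · rw [natCast_add_one, hc0, hc1]

/-- The second family, with `k = 2 * r + 1` and `m = r + 2`. -/
theorem exists_isHigherAuslander_rank_add_three {r : ℕ} (hr : 0 < r) :
    ∃ I : TwoSidedIdeal (PathAlgebra K (CyclicQuiver (2 * r + 4))),
      IsCyclicNakayama I ∧
      HasKupischSeries I (([r + 2] ++ List.replicate (r + 1) (r + 1)) ++
        ([r + 2] ++ List.replicate (r + 1) (r + 1))) ∧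
      algebraRank (BoundQuiverAlgebra I) = 2 * r + 4 ∧
      IsHigherAuslander K (BoundQuiverAlgebra I) ∧
      globalDimension (BoundQuiverAlgebra I) = (2 * r + 1 : ℕ) := by
  let c : CyclicQuiver (2 * r + 4) → ℕ := fun a =>
    if ZMod.val (a : ZMod (2 * r + 4)) % (r + 2) = 0 then r + 2 else r + 1
  have hcle : ∀ a, r + 1 ≤ c a := fun a => by simp only [c]; split_ifs <;> lia
  have hcle' : ∀ a, c a ≤ r + 2 := fun a => by simp only [c]; split_ifs <;> lia
  have hci : ∀ i : ℕ, c (i : CyclicQuiver (2 * r + 4)) =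
      if i % (r + 2) = 0 then r + 2 else r + 1 := by
    intro i
    have h : ZMod.val ((i : CyclicQuiver (2 * r + 4)) : ZMod (2 * r + 4)) = i % (2 * r + 4) :=
      ZMod.val_natCast _ i
    simp only [c]
    rw [h, Nat.mod_mod_of_dvd i ⟨2, by ring⟩]
  let H : Set (ZMod (2 * r + 4)) := {h | ∃ j : ℕ, h = ((r + 2) * j : ℕ)}
  have hn : ((r + 2 : ℕ) + (r + 2 : ℕ) : ZMod (2 * r + 4)) = 0 := by
    rw [← Nat.cast_add, show r + 2 + (r + 2) = 2 * r + 4 by lia, ZMod.natCast_self]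
  have hH : ∀ h ∈ H, h + (r + 2 : ℕ) ∈ H := by
    rintro _ ⟨j, rfl⟩
    exact ⟨j + 1, by rw [← Nat.cast_add, mul_add, mul_one]⟩
  have hc0 : ∀ h ∈ H, c h = r + 2 := by
    rintro _ ⟨j, rfl⟩
    refine (hci _).trans (if_pos ?_)
    simp
  have hc1 : ∀ h ∈ H, ∀ i : ℕ, 0 < i → i < r + 2 → c (h + (i : ZMod (2 * r + 4))) = r + 1 := by
    rintro _ ⟨j, rfl⟩ i hi hi'
    rw [← Nat.cast_add]
    refine (hci _).trans (if_neg ?_)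
    rw [Nat.mul_add_mod, Nat.mod_eq_of_lt hi']
    lia
  have hcov : ∀ a : ZMod (2 * r + 4), ∃ h ∈ H, ∃ i < r + 2, a = h + (i : ℕ) := by
    intro a
    refine ⟨_, ⟨a.val / (r + 2), rfl⟩, a.val % (r + 2), Nat.mod_lt _ (by lia), ?_⟩
    rw [← Nat.cast_add, Nat.div_add_mod, ZMod.natCast_zmod_val]
  refine exists_isHigherAuslander K (c := c) (fun a => (hcle' a).trans (Nat.succ_le_succ (hcle _)))
    (fun a => le_trans (by lia) (hcle a)) (by simp; lia)
    (fun i hi => ?_) (by lia)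
    (CyclicPresentation.projectiveDimensionLE_simple_of_mem _ hr hH hc0 hc1 hcov)
    (CyclicPresentation.projectiveInjectiveTerms_projective_of_mem _ hn hH hc0 hc1 hcov)
    ((0 : ℕ) : CyclicQuiver (2 * r + 4)) ?_
  · have hi : i < 2 * r + 4 := by
      simp at hi; lia
    rw [hci]
    rcases Nat.lt_or_ge i (r + 2) with h | h
    · rw [Nat.mod_eq_of_lt h, List.getElem_append_left (by simp; lia)]
      rcases i with _ | i <;> simp
    · obtain ⟨i, rfl⟩ := Nat.exists_eq_add_of_le h
      rw [Nat.add_mod_left, Nat.mod_eq_of_lt (by lia), List.getElem_append_right (by simp)]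
      rcases i with _ | i <;> simp
  · rw [natCast_add_one, hci, hci, zero_add, Nat.mod_eq_of_lt (by lia)]
    simp

end CyclicQuiver

/-- For every field `K` and every odd `k ≥ 3` there are cyclic Nakayama algebras over `K` that are
higher Auslander algebras of global dimension `k`: one of rank `k + 2`, with Kupisch series
`(n, n - 1, (n - 2)^(n - 2))` where `n = k + 2`, and one of rank `k + 3`, with Kupisch series
`(m, (m - 1)^(m - 1), m, (m - 1)^(m - 1))` where `m = (k + 3) / 2`. -/
theorem mainTheorem10 (K : Type u) [Field K] (k : ℕ) (hk : Odd k) (hk3 : 3 ≤ k) :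
    (∃ I : TwoSidedIdeal (PathAlgebra K (CyclicQuiver (k + 2))),
      IsCyclicNakayama I ∧
      HasKupischSeries I ([k + 2, k + 1] ++ List.replicate k k) ∧
      algebraRank (BoundQuiverAlgebra I) = k + 2 ∧
      IsHigherAuslander K (BoundQuiverAlgebra I) ∧
      globalDimension (BoundQuiverAlgebra I) = k) ∧
    (∃ m : ℕ, 2 * m = k + 3 ∧ ∃ I : TwoSidedIdeal (PathAlgebra K (CyclicQuiver (k + 3))),
      IsCyclicNakayama I ∧
      HasKupischSeries I
        (([m] ++ List.replicate (m - 1) (m - 1)) ++ ([m] ++ List.replicate (m - 1) (m - 1))) ∧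
      algebraRank (BoundQuiverAlgebra I) = k + 3 ∧
      IsHigherAuslander K (BoundQuiverAlgebra I) ∧
      globalDimension (BoundQuiverAlgebra I) = k) := by
  obtain ⟨r, rfl⟩ := hk
  exact ⟨CyclicQuiver.exists_isHigherAuslander_rank_add_two K (by lia), r + 2, by lia,
    CyclicQuiver.exists_isHigherAuslander_rank_add_three K (by lia)⟩
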